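/- Let $L$ be a finite extension of $\mathbb{Q}_p$ with ring of integers $\mathcal{O}$ and normalized absolute value $|\cdot|$ (so $d(cx)=|c|\,dx$ for an additive Haar measure $dx$). Let $\psi=\psi_{\mathbb{Q}_p}\circ \mathrm{Tr}_{L/\mathbb{Q}_p}$, where $\psi_{\mathbb{Q}_p}(x)=e^{2\pi i\lambda(x)}$ for any rational $\lambda(x)=n/p^k$ with $\lambda(x)-x\in\mathbb{Z}_p$. Fix a Haar measure $d^\times x$ on $L^\times$. For $g:L^\times\to\mathbb{C}$, a unitary character $\chi$ of $L^\times$ and $s\in\mathbb{C}$, put $M(g,s,\chi)=\int_{L^\times} g(x)|x|^s\chi(x)\,d^\times x$, which is said to be well defined if the integral converges absolutely. A number $M_f(s,\chi)$ is the weak Mellin transform of $f$ at $(s,\chi)$ if for every locally constant compactly supported $\phi:L^\times\to\mathbb{C}$ the convolution $(\phi\star f)(y)=\int_{L^\times}\phi(x)f(x^{-1}y)\,d^\times x$ converges absolutely for all $y\in L^\times$, $M(\phi\star f,s,\chi)$ is well defined, and $M(\phi\star f,s,\chi)=M_f(s,\chi)\,M(\phi,s,\chi)$. **Theorem.** Let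 $a,b\in L$ with $a\neq 0$, let $f(x)=\psi(\tfrac12ax^2+bx)$, and let $\chi$ be a continuous unitary character of $L^\times$ that is ramified, i.e. nontrivial on $\mathcal{O}^\times$. Then there is a unique entire function $s\mapsto\zeta_f(s,\chi)$ whose value at every $s$ with $\mathrm{Re}(s)>0$ is the weak Mellin transform of $f$ at $(s,\chi)$. If $\zeta_f(\cdot,\chi)$ is not identically zero, then all its zeros lie on the line $\mathrm{Re}(s)=\tfrac12$. -/

import Mathlib

open MeasureTheory

namespace WeakMellin

/-- `r` is a rational number of the form `n / p ^ k` with `r - x ∈ ℤ_p`. -/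
def IsPrincipalPart (p : ℕ) [Fact p.Prime] (x : ℚ_[p]) (r : ℚ) : Prop :=
  (∃ (n : ℤ) (k : ℕ), r = n / (p : ℚ) ^ k) ∧ ‖(r : ℚ_[p]) - x‖ ≤ 1

theorem exists_isPrincipalPart (p : ℕ) [Fact p.Prime] (x : ℚ_[p]) :
    ∃ r : ℚ, IsPrincipalPart p x r := by
  have hp : (1 : ℝ) < p := by exact_mod_cast (Fact.out : p.Prime).one_lt
  have hp0 : (p : ℚ_[p]) ≠ 0 := by exact_mod_cast (Fact.out : p.Prime).ne_zero
  obtain ⟨k, hk⟩ := pow_unbounded_of_one_lt ‖x‖ hp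
  have hz : ‖(p : ℚ_[p]) ^ k * x‖ ≤ 1 := by
    rw [norm_mul, norm_pow, Padic.norm_p, inv_pow, inv_mul_le_iff₀ (by positivity)]
    linarith
  obtain ⟨z, hzz⟩ : ∃ z : ℤ_[p], (z : ℚ_[p]) = (p : ℚ_[p]) ^ k * x := ⟨⟨_, hz⟩, rfl⟩
  obtain ⟨w, hw⟩ := Ideal.mem_span_singleton.1 (PadicInt.appr_spec k z)
  have hw' : (z : ℚ_[p]) - (z.appr k : ℚ_[p]) = (p : ℚ_[p]) ^ k * (w : ℚ_[p]) := by
    have := congrArg (fun t : ℤ_[p] => (t : ℚ_[p])) hw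
    simpa using this
  refine ⟨((z.appr k : ℤ) : ℚ) / (p : ℚ) ^ k, ⟨_, k, rfl⟩, ?_⟩
  have : (((((z.appr k : ℤ) : ℚ) / (p : ℚ) ^ k : ℚ)) : ℚ_[p]) - x = -(w : ℚ_[p]) := by
    push_cast
    field_simp
    rw [hzz] at hw'
    linear_combination -hw'
  rw [this, norm_neg]
  exact w.2

/-- The standard additive character `x ↦ exp (2πi λ(x))` of `ℚ_p`, where `λ(x)` is any rational
number `n / p ^ k` with `λ(x) - x ∈ ℤ_p`. -/
noncomputable def padicChar (p : ℕ) [Fact p.Prime] (x : ℚ_[p]) : ℂ :=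
  Complex.exp (2 * Real.pi * Complex.I * ((Classical.choose (exists_isPrincipalPart p x) : ℚ) : ℂ))

/-- The value of the standard character does not depend on the choice of `λ(x)`. -/
theorem padicChar_eq (p : ℕ) [Fact p.Prime] (x : ℚ_[p]) (r : ℚ) (hr : IsPrincipalPart p x r) :
    padicChar p x = Complex.exp (2 * Real.pi * Complex.I * (r : ℂ)) := by
  have hp0 : (p : ℚ) ≠ 0 := by exact_mod_cast (Fact.out : p.Prime).ne_zero
  have hp0' : (p : ℚ_[p]) ≠ 0 := by exact_mod_cast (Fact.out : p.Prime).ne_zero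
  obtain ⟨⟨n, k, hn⟩, h1⟩ := hr
  obtain ⟨⟨m, l, hm⟩, h2⟩ := Classical.choose_spec (exists_isPrincipalPart p x)
  unfold padicChar
  set t := Classical.choose (exists_isPrincipalPart p x)
  have h3 : ‖(t : ℚ_[p]) - (r : ℚ_[p])‖ ≤ 1 := by
    have : (t : ℚ_[p]) - r = (t - x) - (r - x) := by ring
    rw [this, sub_eq_add_neg]
    refine (Padic.nonarchimedean _ _).trans ?_
    rw [norm_neg]
    exact max_le h2 h1
  have h4 : t - r = ((m * p ^ k - n * p ^ l : ℤ) : ℚ) / (p : ℚ) ^ (l + k) := by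
    rw [hm, hn]; push_cast; rw [pow_add]; field_simp
  have h5 : ((p ^ (l + k) : ℕ) : ℤ) ∣ (m * p ^ k - n * p ^ l : ℤ) := by
    push_cast
    rw [← Padic.norm_int_le_pow_iff_dvd (p := p)]
    have h6 : (((m * p ^ k - n * p ^ l : ℤ)) : ℚ_[p])
        = ((t : ℚ_[p]) - r) * (p : ℚ_[p]) ^ (l + k) := by
      have : ((m * p ^ k - n * p ^ l : ℤ) : ℚ) = (t - r) * (p : ℚ) ^ (l + k) := by
        rw [h4]; field_simp
      exact_mod_cast congrArg (fun q : ℚ => (q : ℚ_[p])) this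
    rw [h6, norm_mul, norm_pow, Padic.norm_p, inv_pow, zpow_neg, zpow_natCast]
    exact mul_le_of_le_one_left (by positivity) h3
  obtain ⟨j, hj⟩ := h5
  have h7 : t = r + j := by
    rw [hj] at h4
    push_cast at h4
    have : t - r = j := by rw [h4]; field_simp
    linarith
  rw [h7, Complex.exp_eq_exp_iff_exists_int]
  exact ⟨j, by push_cast; ring⟩

section LocalField

variable (p : ℕ) [Fact p.Prime] {L : Type*} [NormedField L] [NormedAlgebra ℚ_[p] L]

/-- The standard additive character of a finite extension `L` of `ℚ_p`. -/
noncomputable def stdChar (x : L) : ℂ := padicChar p (Algebra.trace ℚ_[p] L x)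

/-- The function `x ↦ ψ(½ a x² + b x)` on `L`. -/
noncomputable def secondDegreeChar (a b : L) (x : L) : ℂ := stdChar p (a / 2 * x ^ 2 + b * x)

end LocalField

section MellinTransform

variable {L : Type*} [NormedField L] [LocallyCompactSpace L]

/-- The normalized absolute value of `x ∈ Lˣ`: the factor by which multiplication by `x` scales
the additive Haar measures of `L`. -/
noncomputable def normAbs (x : Lˣ) : ℝ := (distribHaarChar L x : ℝ)

/-- The quasi-character `x ↦ |x|^s χ(x)` of `Lˣ`. -/
noncomputable def quasiChar (s : ℂ) (χ : Lˣ →ₜ* Circle) (x : Lˣ) : ℂ :=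
  (normAbs x : ℂ) ^ s * (χ x : ℂ)

variable [MeasurableSpace L] (ν : Measure Lˣ)

/-- The integral defining the Mellin transform of `g` at `(s, χ)` converges absolutely. -/
def MellinWellDefined (g : Lˣ → ℂ) (s : ℂ) (χ : Lˣ →ₜ* Circle) : Prop :=
  Integrable (fun x => g x * quasiChar s χ x) ν

/-- The Mellin transform `∫ g(x) |x|^s χ(x) d×x`. -/
noncomputable def mellinTransform (g : Lˣ → ℂ) (s : ℂ) (χ : Lˣ →ₜ* Circle) : ℂ :=
  ∫ x, g x * quasiChar s χ x ∂ν

/-- Multiplicative convolution `(φ ⋆ f)(y) = ∫ φ(x) f(x⁻¹ y) d×x`. -/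
noncomputable def mulConv (φ : Lˣ → ℂ) (f : Lˣ → ℂ) (y : Lˣ) : ℂ :=
  ∫ x, φ x * f (x⁻¹ * y) ∂ν

/-- `M` is the value at `(s, χ)` of the weak Mellin transform of `f`: for every locally constant
compactly supported `φ` on `Lˣ`, `φ ⋆ f` is well defined, its Mellin transform at `(s, χ)`
converges absolutely, and it equals `M` times the Mellin transform of `φ`. -/
def IsWeakMellinAt (f : Lˣ → ℂ) (s : ℂ) (χ : Lˣ →ₜ* Circle) (M : ℂ) : Prop :=
  ∀ φ : Lˣ → ℂ, IsLocallyConstant φ → HasCompactSupport φ →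
    (∀ y, Integrable (fun x => φ x * f (x⁻¹ * y)) ν) ∧
    MellinWellDefined ν (mulConv ν φ f) s χ ∧
    mellinTransform ν (mulConv ν φ f) s χ = M * mellinTransform ν φ s χ

/-- `Z` is the function `s ↦ ζ_f(s, χ)`: the weak Mellin transform of `f` on `Re s > 0`, continued
analytically to the whole plane. -/
def IsEntireZeta (f : L → ℂ) (χ : Lˣ →ₜ* Circle) (Z : ℂ → ℂ) : Prop :=
  Differentiable ℂ Z ∧
    ∀ s : ℂ, 0 < s.re → IsWeakMellinAt ν (fun x : Lˣ => f (x : L)) s χ (Z s)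

end MellinTransform

/-- `χ` is ramified: it is not trivial on the group of units of the ring of integers. -/
def IsRamified {L : Type*} [NormedField L] (χ : Lˣ →ₜ* Circle) : Prop :=
  ∃ u : Lˣ, ‖(u : L)‖ = 1 ∧ χ u ≠ 1

end WeakMellin

/-!
Write `f (x) = ψ (a x ^ 2 / 2 + b x)` and let `ϖ` be a uniformizer. The group `Lˣ` is the disjoint
union of the shells `ϖ ^ n 𝒪ˣ`, on each of which `|x| ^ s` is constant, so formally the zeta
function is the Laurent series `∑ c_n |ϖ| ^ (n s)`, where `c_n` is, up to a factor of constant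
modulus, the integral of `f (ϖ ^ n u) χ(u)` over the units `u` of `𝒪` (`shellCoeff`). After
rescaling, `ψ` is trivial on `𝒪` but not on `ϖ⁻¹ 𝒪`. Let `m ≥ 1` be the conductor exponent of `χ`
and `α` the valuation of `a`. Two facts about the coefficients give everything.

* *At most one coefficient with `2 n + α + m ≥ 0` is nonzero* (`shellCoeff_eq_zero_of_lt`). If
  `c_n ≠ 0`, stationary phase provides a unit `u` such that the phase of the integrand does not move
  under small translations of `u` (`exists_stationary`). This forces `f` to be trivial on
  `ϖ ^ (n + m) 𝒪`. On a shell `n' > n` the function `f (ϖ ^ n' u)` is then invariant under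
  `u ↦ u w` for `w ≡ 1` modulo `ϖ ^ (m - 1)`, and `χ` is nontrivial on these `w`, so `c_n' = 0`.
  The argument is uniform in the residue characteristic: no `p`-adic expansion of the critical
  points is needed, which for `p = 2` may be degenerate.

* *A functional equation holds shell by shell*: `|c_n| ^ 2 |ϖ| ^ n`, with `|ϖ|` the normalized
  absolute value, is invariant under the reflection `n ↦ -m - α - n` (`norm_sq_shellCoeff`).
  Expanding `χ` on the units into additive characters by means of its Gauss sums and completing the
  square turns `c_n` into the complex conjugate of the reflected coefficient times a quadratic Gauss
  integral (`norm_shellCoeff_mul_gaussSumAt`). The moduli of the Gauss sum and of the Gauss integral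
  need not be computed: the latter scales by a power of `|ϖ|` from shell to shell, and applying the
  equation twice determines the rest.

Hence either all coefficients vanish, or one does not and it is fixed by the reflection, or exactly
two do not and they are exchanged by it (`eq_or_eq_reflection`). In the second case the zeta
function is a nonvanishing exponential. In the third it is a sum of two exponentials, and at a zero
both terms have equal modulus; by the functional equation this happens only if `Re s = 1 / 2`.

That this finite sum is the weak Mellin transform on `Re s > 0` follows by decomposing the Mellin
transform of `φ ⋆ f` into shells (`mellinTransform_mulConv`). Convergence holds because `φ ⋆ f` is
constant near `0`, where `f = 1`, and vanishes near infinity, where `f` averages to zero over the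
cosets of a higher unit group leaving `φ` invariant (`exists_integral_quadChar_eq_zero`). Uniqueness
follows by testing on the indicator function of a higher unit group and by the identity theorem.
-/

namespace WeakMellin

/-! ### Fractional ideals of a nonarchimedean local field -/

section Ideals

variable {L : Type*} [NormedField L]

/-- `ϖ` is a uniformizer: a nonzero element of norm less than `1` whose integral powers realize
all norms of nonzero elements. -/
structure IsUniformizer (ϖ : L) : Prop where
  ne_zero : ϖ ≠ 0
  norm_lt_one : ‖ϖ‖ < 1
  exists_zpow : ∀ x : L, x ≠ 0 → ∃ n : ℤ, ‖x‖ = ‖ϖ‖ ^ n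

theorem IsUniformizer.norm_pos {ϖ : L} (h : IsUniformizer ϖ) : 0 < ‖ϖ‖ := norm_pos_iff.2 h.ne_zero

theorem IsUniformizer.zpow_norm_le_iff {ϖ : L} (h : IsUniformizer ϖ) {k l : ℤ} :
    ‖ϖ‖ ^ k ≤ ‖ϖ‖ ^ l ↔ l ≤ k :=
  zpow_le_zpow_iff_right_of_lt_one₀ h.norm_pos h.norm_lt_one

theorem IsUniformizer.zpow_norm_inj {ϖ : L} (h : IsUniformizer ϖ) {k l : ℤ} :
    ‖ϖ‖ ^ k = ‖ϖ‖ ^ l ↔ k = l :=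
  zpow_right_inj₀ h.norm_pos h.norm_lt_one.ne

variable [IsUltrametricDist L]

/-- A uniformizer is an element of maximal norm in the open unit ball, which is compact. -/
theorem exists_isUniformizer [ProperSpace L] {x₀ : L} (h0 : x₀ ≠ 0) (h1 : ‖x₀‖ < 1) :
    ∃ ϖ : L, IsUniformizer ϖ := by
  have hc : IsCompact (Metric.ball (0 : L) 1) :=
    (isCompact_closedBall (0 : L) 1).of_isClosed_subset (IsUltrametricDist.isClosed_ball _ _)
      Metric.ball_subset_closedBall
  obtain ⟨ϖ, hϖ, hmax⟩ := hc.exists_isMaxOn ⟨x₀, by simpa using h1⟩ continuous_norm.continuousOn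
  have hϖ1 : ‖ϖ‖ < 1 := by simpa using hϖ
  have hmax' : ∀ y : L, ‖y‖ < 1 → ‖y‖ ≤ ‖ϖ‖ := fun y hy => hmax (by simpa using hy)
  have hpos : 0 < ‖ϖ‖ := (norm_pos_iff.2 h0).trans_le (hmax' _ h1)
  have hne : ϖ ≠ 0 := norm_pos_iff.1 hpos
  refine ⟨ϖ, hne, hϖ1, fun x hx => ?_⟩
  obtain ⟨n, hn1, hn2⟩ := exists_mem_Ico_zpow (norm_pos_iff.2 hx) ((one_lt_inv₀ hpos).2 hϖ1)
  -- `x * ϖ ^ (n + 1)` has norm in `[‖ϖ‖, 1)`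
  refine ⟨-n, ?_⟩
  have e1 : ‖x * ϖ ^ (n + 1)‖ < 1 := by
    rw [norm_mul, norm_zpow]
    rw [inv_zpow, lt_inv_comm₀ (norm_pos_iff.2 hx) (by positivity)] at hn2
    calc ‖x‖ * ‖ϖ‖ ^ (n + 1) < ‖x‖ * ‖x‖⁻¹ := by gcongr
      _ = 1 := mul_inv_cancel₀ (norm_ne_zero_iff.2 hx)
  have e2 := hmax' _ e1
  rw [norm_mul, norm_zpow, zpow_add_one₀ hpos.ne', ← mul_assoc] at e2
  have e3 : ‖x‖ * ‖ϖ‖ ^ n ≤ 1 := le_of_mul_le_mul_right (by simpa using e2) hpos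
  apply le_antisymm
  · rw [zpow_neg]
    exact (le_inv_comm₀ (norm_pos_iff.2 hx) (by positivity)).2
      ((le_inv_mul_iff₀ (norm_pos_iff.2 hx)).2 e3 |>.trans (by simp))
  · rwa [zpow_neg, ← inv_zpow]

/-- The fractional ideal `ϖ ^ k 𝒪`, given as the closed ball of radius `‖ϖ‖ ^ k`. -/
def fracIdeal (ϖ : L) (k : ℤ) : AddSubgroup L where
  carrier := {x | ‖x‖ ≤ ‖ϖ‖ ^ k}
  zero_mem' := by simp only [Set.mem_ofPred_eq, norm_zero]; positivity
  add_mem' {x y} hx hy := (IsUltrametricDist.norm_add_le_max x y).trans (max_le hx hy)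
  neg_mem' {x} hx := by simpa using hx

theorem mem_fracIdeal {ϖ x : L} {k : ℤ} : x ∈ fracIdeal ϖ k ↔ ‖x‖ ≤ ‖ϖ‖ ^ k := Iff.rfl

theorem coe_fracIdeal (ϖ : L) (k : ℤ) :
    (fracIdeal ϖ k : Set L) = Metric.closedBall 0 (‖ϖ‖ ^ k) := by
  ext x; simp [mem_fracIdeal]

theorem mem_fracIdeal_zero {ϖ x : L} : x ∈ fracIdeal ϖ 0 ↔ ‖x‖ ≤ 1 := by
  simp [mem_fracIdeal]

variable {ϖ : L} (hϖ : IsUniformizer ϖ)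
include hϖ

theorem mul_mem_fracIdeal {x y : L} {k l : ℤ} (hx : x ∈ fracIdeal ϖ k) (hy : y ∈ fracIdeal ϖ l) :
    x * y ∈ fracIdeal ϖ (k + l) := by
  rw [mem_fracIdeal] at *
  rw [norm_mul, zpow_add₀ hϖ.norm_pos.ne']
  gcongr

theorem fracIdeal_anti {k l : ℤ} (h : l ≤ k) : fracIdeal ϖ k ≤ fracIdeal ϖ l :=
  fun _ hx => le_trans hx (hϖ.zpow_norm_le_iff.2 h)

theorem isClopen_fracIdeal (k : ℤ) : IsClopen (fracIdeal ϖ k : Set L) := by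
  rw [coe_fracIdeal]
  exact IsUltrametricDist.isClopen_closedBall _ (zpow_ne_zero _ hϖ.norm_pos.ne')

omit hϖ in
theorem isCompact_fracIdeal [ProperSpace L] (k : ℤ) : IsCompact (fracIdeal ϖ k : Set L) := by
  rw [coe_fracIdeal]
  exact isCompact_closedBall _ _

theorem mem_fracIdeal_of_lt {x : L} {k : ℤ} (h : ‖x‖ < ‖ϖ‖ ^ k) : x ∈ fracIdeal ϖ (k + 1) := by
  by_cases hx : x = 0
  · rw [hx]; exact zero_mem _
  obtain ⟨n, hn⟩ := hϖ.exists_zpow x hx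
  rw [hn] at h
  rw [mem_fracIdeal, hn, hϖ.zpow_norm_le_iff]
  have := (zpow_lt_zpow_iff_right_of_lt_one₀ hϖ.norm_pos hϖ.norm_lt_one).1 h
  omega

theorem norm_eq_one_iff {x : L} : ‖x‖ = 1 ↔ x ∈ fracIdeal ϖ 0 ∧ x ∉ fracIdeal ϖ 1 := by
  rw [mem_fracIdeal_zero]
  constructor
  · intro h
    refine ⟨h.le, fun h' => ?_⟩
    rw [mem_fracIdeal, h, zpow_one] at h'
    exact absurd hϖ.norm_lt_one h'.not_gt
  · rintro ⟨h1, h2⟩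
    by_contra h
    exact h2 (by simpa using mem_fracIdeal_of_lt hϖ (k := 0) (by simpa using lt_of_le_of_ne h1 h))

theorem norm_add_eq_one_iff {x t : L} (ht : t ∈ fracIdeal ϖ 1) : ‖x + t‖ = 1 ↔ ‖x‖ = 1 := by
  rw [norm_eq_one_iff hϖ, norm_eq_one_iff hϖ, AddSubgroup.add_mem_cancel_right _ ht,
    AddSubgroup.add_mem_cancel_right _ (fracIdeal_anti hϖ zero_le_one ht)]

omit hϖ in
theorem mul_mem_fracIdeal_iff_of_norm_eq_one {u x : L} {k : ℤ} (hu : ‖u‖ = 1) :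
    u * x ∈ fracIdeal ϖ k ↔ x ∈ fracIdeal ϖ k := by
  rw [mem_fracIdeal, mem_fracIdeal, norm_mul, hu, one_mul]

theorem zpow_mul_mem_fracIdeal_iff {x : L} {k n : ℤ} :
    ϖ ^ n * x ∈ fracIdeal ϖ k ↔ x ∈ fracIdeal ϖ (k - n) := by
  rw [mem_fracIdeal, mem_fracIdeal, norm_mul, norm_zpow, zpow_sub₀ hϖ.norm_pos.ne', le_div_iff₀']
  exact zpow_pos hϖ.norm_pos _

omit hϖ in
theorem zpow_mem_fracIdeal (k : ℤ) : ϖ ^ k ∈ fracIdeal ϖ k := by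
  rw [mem_fracIdeal, norm_zpow]

/-- The ideals `ϖ ^ k 𝒪` form a neighbourhood basis of `0`. -/
theorem exists_fracIdeal_subset {s : Set L} (hs : s ∈ nhds (0 : L)) :
    ∃ k : ℕ, (fracIdeal ϖ k : Set L) ⊆ s := by
  obtain ⟨r, hr, hrs⟩ := Metric.nhds_basis_closedBall.mem_iff.1 hs
  obtain ⟨k, hk⟩ := exists_pow_lt_of_lt_one hr hϖ.norm_lt_one
  refine ⟨k, fun x hx => hrs ?_⟩
  rw [SetLike.mem_coe, mem_fracIdeal, zpow_natCast] at hx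
  simpa using hx.trans hk.le

theorem exists_mem_fracIdeal (x : L) : ∃ k : ℤ, x ∈ fracIdeal ϖ k := by
  by_cases hx : x = 0
  · exact ⟨0, hx ▸ zero_mem _⟩
  · obtain ⟨n, hn⟩ := hϖ.exists_zpow x hx
    exact ⟨n, hn.le⟩

end Ideals

/-! ### Integration on the additive group -/

section Modulus

variable {L : Type*} [NormedField L] [LocallyCompactSpace L]

theorem normAbs_pos (c : Lˣ) : 0 < normAbs c := NNReal.coe_pos.2 distribHaarChar_pos

theorem normAbs_mul (c d : Lˣ) : normAbs (c * d) = normAbs c * normAbs d := by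
  simp [normAbs]

variable [MeasurableSpace L] [BorelSpace L]

theorem measure_units_smul [SecondCountableTopology L] (μ : Measure L) [μ.IsAddHaarMeasure]
    (c : Lˣ) (s : Set L) : μ ((fun x => (c : L) * x) '' s) = ENNReal.ofReal (normAbs c) * μ s := by
  have := distribHaarChar_mul μ c s
  rw [normAbs, ENNReal.ofReal_coe_nnreal, this]
  rfl

theorem integral_comp_units_mul [SecondCountableTopology L] (μ : Measure L) [μ.IsAddHaarMeasure]
    (c : Lˣ) (g : L → ℂ) : (normAbs c : ℂ) * ∫ x, g (c * x) ∂μ = ∫ x, g x ∂μ := by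
  let e : L ≃ₜ L := Homeomorph.mulLeft₀ (c : L) c.ne_zero
  have hm : μ = ENNReal.ofReal (normAbs c) • μ.map e := by
    ext s hs
    rw [Measure.smul_apply, Measure.map_apply e.continuous.measurable hs, smul_eq_mul,
      ← measure_units_smul μ c]
    congr 1
    exact (Set.image_preimage_eq s e.surjective).symm
  conv_rhs => rw [hm]
  rw [integral_smul_measure, ENNReal.toReal_ofReal (normAbs_pos c).le,
    e.measurableEmbedding.integral_map]
  simp [e]

theorem normAbs_eq_one [ProperSpace L] {c : Lˣ} (hc : ‖(c : L)‖ = 1) : normAbs c = 1 := by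
  have h := measure_units_smul (Measure.addHaar (G := L)) c (Metric.closedBall 0 1)
  have himg : (fun x => (c : L) * x) '' Metric.closedBall 0 1 = Metric.closedBall 0 1 := by
    ext x
    simp only [Set.mem_image, mem_closedBall_zero_iff]
    constructor
    · rintro ⟨y, hy, rfl⟩
      rwa [norm_mul, hc, one_mul]
    · intro hx
      refine ⟨(c : L)⁻¹ * x, ?_, by simp⟩
      rwa [norm_mul, norm_inv, hc, inv_one, one_mul]
  rw [himg] at h
  have h0 : (Measure.addHaar (G := L)) (Metric.closedBall 0 1) ≠ 0 :=
    (Metric.measure_closedBall_pos _ _ one_pos).ne'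
  have h1 : (Measure.addHaar (G := L)) (Metric.closedBall 0 1) ≠ ⊤ :=
    (isCompact_closedBall _ _).measure_lt_top.ne
  have h2 : ENNReal.ofReal (normAbs c) = 1 := by
    rw [← ENNReal.mul_left_inj h0 h1, one_mul, ← h]
  rwa [ENNReal.ofReal_eq_one] at h2

/-- The ideal `ϖ 𝒪` and its translate by `1` are disjoint subsets of `𝒪` of equal measure. -/
theorem normAbs_uniformizer_lt_one [ProperSpace L] [IsUltrametricDist L] {c : Lˣ}
    (hc : IsUniformizer (c : L)) : normAbs c < 1 := by
  set μ := Measure.addHaar (G := L)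
  have himg : (fun x => (c : L) * x) '' (fracIdeal (c : L) 0) = fracIdeal (c : L) 1 := by
    ext x
    simp only [Set.mem_image, SetLike.mem_coe]
    constructor
    · rintro ⟨y, hy, rfl⟩
      simpa using mul_mem_fracIdeal hc (zpow_mem_fracIdeal (ϖ := (c : L)) 1) hy
    · intro hx
      refine ⟨(c : L)⁻¹ * x, ?_, by simp⟩
      have := (zpow_mul_mem_fracIdeal_iff hc (x := x) (k := 0) (n := -1)).2 (by simpa using hx)
      simpa using this
  have h := measure_units_smul μ c (fracIdeal (c : L) 0)
  rw [himg] at h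
  have h0 : 0 < μ (fracIdeal (c : L) 0) := by
    rw [coe_fracIdeal]; exact Metric.measure_closedBall_pos _ _ (by simp)
  have h1 : μ (fracIdeal (c : L) 0) ≠ ⊤ := (isCompact_fracIdeal 0).measure_lt_top.ne
  have h2 : μ (fracIdeal (c : L) 1) + μ (fracIdeal (c : L) 1) ≤ μ (fracIdeal (c : L) 0) := by
    have ht : μ ((fun x => (1 : L) + x) '' (fracIdeal (c : L) 1)) = μ (fracIdeal (c : L) 1) := by
      simp
    nth_rewrite 2 [← ht]
    rw [← measure_union]
    · apply measure_mono
      rintro x (hx | ⟨y, hy, rfl⟩)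
      · exact fracIdeal_anti hc zero_le_one hx
      · exact add_mem (mem_fracIdeal_zero.2 (by simp)) (fracIdeal_anti hc zero_le_one hy)
    · rw [Set.disjoint_left]
      rintro x hx ⟨y, hy, rfl⟩
      have : (1 : L) ∈ fracIdeal (c : L) 1 := by simpa using sub_mem hx hy
      exact ((norm_eq_one_iff hc).1 norm_one).2 this
    · exact ((Homeomorph.addLeft (1 : L)).isClosedMap _
        (isClopen_fracIdeal hc 1).1).measurableSet
  by_contra! hge
  have h3 : μ (fracIdeal (c : L) 0) ≤ μ (fracIdeal (c : L) 1) := by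
    rw [h]
    exact le_mul_of_one_le_left zero_le (ENNReal.one_le_ofReal.2 hge)
  have h4 : μ (fracIdeal (c : L) 0) + μ (fracIdeal (c : L) 0) ≤ μ (fracIdeal (c : L) 0) + 0 := by
    rw [add_zero]
    exact (add_le_add h3 h3).trans h2
  exact h0.not_ge ((ENNReal.add_le_add_iff_left h1).1 h4)

end Modulus

section Averages

variable {L : Type*} [NormedField L] [MeasurableSpace L] [BorelSpace L]
  (μ : Measure L) [μ.IsAddHaarMeasure]

/-- A function whose integral over every coset of a compact open subgroup vanishes has integral
zero. -/
theorem integral_eq_zero_of_coset_integrals {B : AddSubgroup L} (hB : IsClopen (B : Set L))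
    (hBc : IsCompact (B : Set L)) {g : L → ℂ} (hg : Continuous g) (hgc : HasCompactSupport g)
    (h : ∀ x, ∫ y in B, g (x + y) ∂μ = 0) : ∫ x, g x ∂μ = 0 := by
  let F : L → L → ℂ := fun x y => (B : Set L).indicator (fun _ => (1 : ℂ)) y * g (x + y)
  have hF : Continuous F.uncurry := by
    have h1 : Continuous ((B : Set L).indicator fun _ => (1 : ℂ)) :=
      continuous_const.indicator (by simp [hB.frontier_eq])
    exact (h1.comp continuous_snd).mul (hg.comp continuous_add)
  have hFc : HasCompactSupport F.uncurry := by
    refine HasCompactSupport.intro (K := (fun z : L × L => (z.1 - z.2, z.2)) ''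
      (tsupport g ×ˢ (B : Set L))) ((hgc.isCompact.prod hBc).image (by fun_prop)) ?_
    rintro ⟨x, y⟩ hxy
    by_contra hne
    refine hxy ⟨(x + y, y), ⟨subset_tsupport _ ?_, ?_⟩, by simp⟩
    · exact right_ne_zero_of_mul hne
    · by_contra hy
      exact left_ne_zero_of_mul hne (Set.indicator_of_notMem hy _)
  have hswap := integral_integral_swap_of_hasCompactSupport hF hFc (μ := μ) (ν := μ)
  have hl : ∀ x, ∫ y, F x y ∂μ = 0 := by
    intro x
    rw [← h x, ← integral_indicator hB.isOpen.measurableSet]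
    congr 1
    ext y
    by_cases hy : y ∈ (B : Set L) <;> simp [F, hy]
  have hr : ∀ y, ∫ x, F x y ∂μ =
      (B : Set L).indicator (fun _ => (1 : ℂ)) y * ∫ x, g x ∂μ := by
    intro y
    simp only [F]
    rw [integral_const_mul, integral_add_right_eq_self]
  simp only [hl, hr, integral_zero] at hswap
  rw [integral_mul_const, integral_indicator_const _ hB.isOpen.measurableSet] at hswap
  have hpos : μ.real (B : Set L) ≠ 0 :=
    (ENNReal.toReal_pos (hB.isOpen.measure_pos μ ⟨0, zero_mem B⟩).ne'
      hBc.measure_lt_top.ne).ne'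
  have := hswap.symm
  simpa [hpos] using this

/-- Orthogonality: a nontrivial character of a subgroup has integral zero over it. -/
theorem setIntegral_eq_zero_of_nontrivial {B : AddSubgroup L} (hB : MeasurableSet (B : Set L))
    {Φ : L → ℂ} (hadd : ∀ x ∈ B, ∀ y ∈ B, Φ (x + y) = Φ x * Φ y) {y : L} (hy : y ∈ B)
    (hΦ : Φ y ≠ 1) : ∫ x in B, Φ x ∂μ = 0 := by
  rw [← integral_indicator hB]
  have h1 : ∀ x, (B : Set L).indicator Φ (x + y) = (B : Set L).indicator Φ x * Φ y := by
    intro x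
    by_cases hx : x ∈ (B : Set L)
    · have hxy : x + y ∈ (B : Set L) := add_mem hx hy
      rw [Set.indicator_of_mem hx, Set.indicator_of_mem hxy, hadd x hx y hy]
    · have hxy : x + y ∉ (B : Set L) := fun h => hx ((AddSubgroup.add_mem_cancel_right _ hy).1 h)
      rw [Set.indicator_of_notMem hx, Set.indicator_of_notMem hxy, zero_mul]
  have h2 := integral_add_right_eq_self (μ := μ) ((B : Set L).indicator Φ) y
  simp only [h1, integral_mul_const] at h2
  by_contra hne
  exact hΦ (mul_left_cancel₀ hne (by rw [h2, mul_one]))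

end Averages

theorem continuous_of_add_fracIdeal {L : Type*} [NormedField L] [IsUltrametricDist L] {ϖ : L}
    (hϖ : IsUniformizer ϖ) {X : Type*} [TopologicalSpace X] {g : L → X} (k : ℤ)
    (hg : ∀ x, ∀ t ∈ fracIdeal ϖ k, g (x + t) = g x) : Continuous g := by
  refine continuous_iff_continuousAt.2 fun x => ?_
  refine ContinuousAt.congr (f := fun _ => g x) continuousAt_const ?_
  have hopen : IsOpen ((fun y => y - x) ⁻¹' (fracIdeal ϖ k : Set L)) :=
    (isClopen_fracIdeal hϖ k).isOpen.preimage (by fun_prop)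
  filter_upwards [hopen.mem_nhds (by simp)] with y hy
  rw [← hg x _ hy]
  simp

/-! ### Additive and multiplicative characters -/

section Characters

variable {L : Type*} [NormedField L]

/-- The restriction of a character of `Lˣ` to the units of the ring of integers, extended by zero
to a function on `L`. -/
noncomputable def unitChar (χ : Lˣ →ₜ* Circle) (x : L) : ℂ :=
  open Classical in
  if h : ‖x‖ = 1 then χ (Units.mk0 x (norm_ne_zero_iff.1 (h ▸ one_ne_zero))) else 0

variable {χ : Lˣ →ₜ* Circle}

theorem unitChar_coe {u : Lˣ} (hu : ‖(u : L)‖ = 1) : unitChar χ u = χ u := by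
  rw [unitChar, dif_pos hu]
  congr 2
  ext; rfl

theorem unitChar_of_norm_ne {x : L} (hx : ‖x‖ ≠ 1) : unitChar χ x = 0 := dif_neg hx

theorem norm_unitChar {x : L} (hx : ‖x‖ = 1) : ‖unitChar χ x‖ = 1 := by
  rw [unitChar, dif_pos hx, Circle.norm_coe]

theorem unitChar_mul {u : L} (hu : ‖u‖ = 1) (x : L) :
    unitChar χ (u * x) = unitChar χ u * unitChar χ x := by
  by_cases hx : ‖x‖ = 1
  · have hux : ‖u * x‖ = 1 := by rw [norm_mul, hu, hx, one_mul]
    rw [unitChar, unitChar, unitChar, dif_pos hu, dif_pos hx, dif_pos hux, ← Circle.coe_mul,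
      ← map_mul]
    congr 2
    ext; rfl
  · have hux : ‖u * x‖ ≠ 1 := by rwa [norm_mul, hu, one_mul]
    rw [unitChar_of_norm_ne hx, unitChar_of_norm_ne hux, mul_zero]

theorem hasCompactSupport_unitChar [ProperSpace L] : HasCompactSupport (unitChar χ) :=
  HasCompactSupport.intro (isCompact_closedBall (0 : L) 1) fun _ hx =>
    unitChar_of_norm_ne fun h => hx (by simp [h])

variable [IsUltrametricDist L]

/-- The ramified character `χ` has conductor exponent `m`: it is trivial on the units congruent to
`1` modulo `ϖ ^ m`, but not on those congruent to `1` modulo `ϖ ^ (m - 1)`. -/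
structure IsConductor (ϖ : L) (χ : Lˣ →ₜ* Circle) (m : ℤ) : Prop where
  one_le : 1 ≤ m
  eq_one : ∀ t ∈ fracIdeal ϖ m, unitChar χ (1 + t) = 1
  exists_ne_one : ∃ t ∈ fracIdeal ϖ (m - 1), ‖1 + t‖ = 1 ∧ unitChar χ (1 + t) ≠ 1

variable {ϖ : L} {m : ℤ}

theorem IsConductor.unitChar_add (hm : IsConductor ϖ χ m) (hϖ : IsUniformizer ϖ) (x : L) {t : L}
    (ht : t ∈ fracIdeal ϖ m) : unitChar χ (x + t) = unitChar χ x := by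
  by_cases hx : ‖x‖ = 1
  · have hx0 : x ≠ 0 := norm_ne_zero_iff.1 (hx ▸ one_ne_zero)
    have h1 : x + t = x * (1 + x⁻¹ * t) := by field_simp
    rw [h1, unitChar_mul hx, hm.eq_one, mul_one]
    exact (mul_mem_fracIdeal_iff_of_norm_eq_one (by rw [norm_inv, hx, inv_one])).2 ht
  · rw [unitChar_of_norm_ne hx, unitChar_of_norm_ne]
    rwa [Ne, norm_add_eq_one_iff hϖ (fracIdeal_anti hϖ hm.one_le ht)]

theorem IsConductor.continuous_unitChar (hm : IsConductor ϖ χ m) (hϖ : IsUniformizer ϖ) :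
    Continuous (unitChar χ) :=
  continuous_of_add_fracIdeal hϖ m fun x _ ht => hm.unitChar_add hϖ x ht

/-- A unitary additive character that is trivial on the ring of integers but not on the next
larger fractional ideal. -/
structure IsNormalized (ϖ : L) (ψ : AddChar L ℂ) : Prop where
  norm_eq_one : ∀ x, ‖ψ x‖ = 1
  eq_one : ∀ x ∈ fracIdeal ϖ 0, ψ x = 1
  exists_ne_one : ∃ x ∈ fracIdeal ϖ (-1), ψ x ≠ 1

variable {ψ : AddChar L ℂ}

theorem IsNormalized.continuous (hψ : IsNormalized ϖ ψ) (hϖ : IsUniformizer ϖ) : Continuous ψ :=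
  continuous_of_add_fracIdeal hϖ 0 fun x t ht => by
    rw [AddChar.map_add_eq_mul, hψ.eq_one t ht, mul_one]

omit [IsUltrametricDist L] in
theorem conj_addChar (h : ∀ x, ‖ψ x‖ = 1) (x : L) :
    (starRingEnd ℂ) (ψ x) = ψ (-x) := by
  rw [AddChar.map_neg_eq_inv, Complex.inv_eq_conj (h x)]

/-- A nonzero element `x` of norm larger than `‖ϖ‖ ^ (-k)` pairs nontrivially with the ideal
`ϖ ^ k 𝒪`. -/
theorem IsNormalized.exists_mul_ne_one (hψ : IsNormalized ϖ ψ) (hϖ : IsUniformizer ϖ) {x : L}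
    {k : ℤ} (hx : x ∉ fracIdeal ϖ (-k)) : ∃ t ∈ fracIdeal ϖ k, ψ (x * t) ≠ 1 := by
  obtain ⟨y, hy, hy1⟩ := hψ.exists_ne_one
  have hx0 : x ≠ 0 := by rintro rfl; exact hx (zero_mem _)
  obtain ⟨n, hn⟩ := hϖ.exists_zpow x hx0
  refine ⟨x⁻¹ * y, ?_, by rwa [mul_inv_cancel_left₀ hx0]⟩
  have h1 : x⁻¹ ∈ fracIdeal ϖ (-n) := by rw [mem_fracIdeal, norm_inv, hn, zpow_neg]
  rw [mem_fracIdeal, hn, hϖ.zpow_norm_le_iff] at hx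
  exact fracIdeal_anti hϖ (by omega) (mul_mem_fracIdeal hϖ h1 hy)

/-- The second degree character `x ↦ ψ (a x² / 2 + b x)`. -/
noncomputable def quadChar (ψ : AddChar L ℂ) (a b x : L) : ℂ := ψ (a / 2 * x ^ 2 + b * x)

omit [IsUltrametricDist L] in
theorem quadChar_add [CharZero L] (a b x y : L) :
    quadChar ψ a b (x + y) = quadChar ψ a b x * quadChar ψ a b y * ψ (a * x * y) := by
  simp only [quadChar, ← AddChar.map_add_eq_mul]
  congr 1
  field_simp
  ring

theorem IsNormalized.continuous_quadChar (hψ : IsNormalized ϖ ψ) (hϖ : IsUniformizer ϖ)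
    (a b : L) : Continuous (quadChar ψ a b) := by
  have := hψ.continuous hϖ
  unfold quadChar
  fun_prop

end Characters

/-! ### Shell coefficients -/

section ShellCoeff

variable {L : Type*} [NormedField L] [MeasurableSpace L]

/-- The integrand of `shellCoeff`. -/
noncomputable def shellFun (ψ : AddChar L ℂ) (χ : Lˣ →ₜ* Circle) (ϖ a b : L) (n : ℤ) (u : L) : ℂ :=
  quadChar ψ a b (ϖ ^ n * u) * unitChar χ u

/-- The additive integral `∫ f (ϖ ^ n u) χ(u) du` over the units `u` of the ring of integers, where
`f` is the second degree character attached to `a` and `b`. Up to a nonzero factor it is the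
contribution of the shell `|x| = |ϖ ^ n|` to the zeta function of `f`. -/
noncomputable def shellCoeff (μ : Measure L) (ψ : AddChar L ℂ) (χ : Lˣ →ₜ* Circle) (ϖ a b : L)
    (n : ℤ) : ℂ :=
  ∫ u, shellFun ψ χ ϖ a b n u ∂μ

variable [BorelSpace L] {μ : Measure L} [μ.IsAddHaarMeasure] [ProperSpace L] [IsUltrametricDist L]
  {ϖ a b : L} {ψ : AddChar L ℂ} {χ : Lˣ →ₜ* Circle} {m α : ℤ} (hϖ : IsUniformizer ϖ)
  (hψ : IsNormalized ϖ ψ) (hm : IsConductor ϖ χ m)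

omit [MeasurableSpace L] [BorelSpace L] [ProperSpace L] in
include hϖ hψ hm in
theorem continuous_shellFun (n : ℤ) : Continuous (shellFun ψ χ ϖ a b n) :=
  ((hψ.continuous_quadChar hϖ a b).comp (by fun_prop)).mul (hm.continuous_unitChar hϖ)

omit [MeasurableSpace L] [BorelSpace L] [IsUltrametricDist L] in
theorem hasCompactSupport_shellFun (n : ℤ) : HasCompactSupport (shellFun ψ χ ϖ a b n) :=
  hasCompactSupport_unitChar.mul_left

omit [IsUltrametricDist L] in
theorem integral_comp_unit_mul (g : L → ℂ) {w : L} (hw : ‖w‖ = 1) :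
    ∫ x, g (w * x) ∂μ = ∫ x, g x ∂μ := by
  have hw0 : w ≠ 0 := norm_ne_zero_iff.1 (hw ▸ one_ne_zero)
  have := integral_comp_units_mul μ (Units.mk0 w hw0) g
  rwa [normAbs_eq_one (by simpa using hw), Complex.ofReal_one, one_mul] at this

variable [CharZero L]

include hϖ hψ hm in
/-- Stationary phase: if the `n`-th shell coefficient is nonzero, then the phase of the integrand
is stationary at some unit `u`. The integrand multiplies by a character of `ϖ ^ j 𝒪` under
translation of `u`, so its integral over `u + ϖ ^ j 𝒪` vanishes unless that character is trivial. -/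
theorem exists_stationary {n j : ℤ} (ha : a ∈ fracIdeal ϖ α) (hj1 : 1 ≤ j) (hjm : m ≤ 2 * j)
    (hjn : 0 ≤ 2 * n + α + 2 * j) (hc : shellCoeff μ ψ χ ϖ a b n ≠ 0) :
    ∃ u : L, ‖u‖ = 1 ∧ ∀ t ∈ fracIdeal ϖ j,
      quadChar ψ a b (ϖ ^ n * t) * ψ (a * (ϖ ^ n * u) * (ϖ ^ n * t)) *
        unitChar χ (1 + u⁻¹ * t) = 1 := by
  by_contra! hcon
  refine hc (integral_eq_zero_of_coset_integrals μ (isClopen_fracIdeal hϖ j)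
    (isCompact_fracIdeal j) (continuous_shellFun hϖ hψ hm n) (hasCompactSupport_shellFun n) ?_)
  intro u
  by_cases hu : ‖u‖ = 1
  · have hu0 : u ≠ 0 := norm_ne_zero_iff.1 (hu ▸ one_ne_zero)
    have hui : ‖u⁻¹‖ = 1 := by rw [norm_inv, hu, inv_one]
    obtain ⟨t₀, ht₀, hne⟩ := hcon u hu
    set Φ : L → ℂ := fun t => quadChar ψ a b (ϖ ^ n * t) * ψ (a * (ϖ ^ n * u) * (ϖ ^ n * t)) *
        unitChar χ (1 + u⁻¹ * t) with hΦ
    have hshift : ∀ t, shellFun ψ χ ϖ a b n (u + t) = shellFun ψ χ ϖ a b n u * Φ t := by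
      intro t
      have h1 : u + t = u * (1 + u⁻¹ * t) := by field_simp
      simp only [shellFun, hΦ]
      rw [mul_add, quadChar_add, h1, unitChar_mul hu]
      ring
    simp only [hshift]
    rw [integral_const_mul, setIntegral_eq_zero_of_nontrivial μ
      (isClopen_fracIdeal hϖ j).isOpen.measurableSet ?_ ht₀ hne, mul_zero]
    intro x hx y hy
    have h1 : ψ (a * (ϖ ^ n * x) * (ϖ ^ n * y)) = 1 := by
      apply hψ.eq_one
      have h2 := mul_mem_fracIdeal hϖ (mul_mem_fracIdeal hϖ ha
        (mul_mem_fracIdeal hϖ (zpow_mem_fracIdeal n) hx))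
        (mul_mem_fracIdeal hϖ (zpow_mem_fracIdeal n) hy)
      exact fracIdeal_anti hϖ (by omega) h2
    have hx' : u⁻¹ * x ∈ fracIdeal ϖ j := (mul_mem_fracIdeal_iff_of_norm_eq_one hui).2 hx
    have hy' : u⁻¹ * y ∈ fracIdeal ϖ j := (mul_mem_fracIdeal_iff_of_norm_eq_one hui).2 hy
    have h3 : unitChar χ (1 + u⁻¹ * (x + y)) =
        unitChar χ (1 + u⁻¹ * x) * unitChar χ (1 + u⁻¹ * y) := by
      rw [← unitChar_mul ((norm_add_eq_one_iff hϖ (fracIdeal_anti hϖ hj1 hx')).2 norm_one)]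
      have h4 : (1 + u⁻¹ * x) * (1 + u⁻¹ * y) =
          1 + u⁻¹ * (x + y) + (u⁻¹ * x) * (u⁻¹ * y) := by ring
      rw [h4, hm.unitChar_add hϖ _
        (fracIdeal_anti hϖ (by omega) (mul_mem_fracIdeal hϖ hx' hy'))]
    simp only [hΦ]
    rw [h3, mul_add, quadChar_add, h1, mul_add, AddChar.map_add_eq_mul]
    ring
  · rw [setIntegral_congr_fun (g := fun _ => (0 : ℂ))
      (isClopen_fracIdeal hϖ j).isOpen.measurableSet]
    · simp
    · intro t ht
      simp only [shellFun]
      rw [unitChar_of_norm_ne (x := u + t), mul_zero]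
      rwa [Ne, norm_add_eq_one_iff hϖ (fracIdeal_anti hϖ hj1 ht)]

include hϖ hψ hm in
/-- On the side of the centre of symmetry `-(α + m) / 2` containing the small elements, at most one
shell coefficient is nonzero: a stationary phase on one shell makes the second degree character
trivial on a fractional ideal, which leaves only the ramified character to integrate on the
shells further inside. -/
theorem shellCoeff_eq_zero_of_lt {n n' : ℤ} (ha : a ∈ fracIdeal ϖ α) (hn : 0 ≤ 2 * n + α + m)
    (hc : shellCoeff μ ψ χ ϖ a b n ≠ 0) (hnn' : n < n') : shellCoeff μ ψ χ ϖ a b n' = 0 := by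
  have hm1 := hm.one_le
  obtain ⟨u, hu, hstat⟩ := exists_stationary hϖ hψ hm (n := n) (j := (m + 1) / 2) ha
    (by omega) (by omega) (by omega) hc
  -- on `ϖ ^ m 𝒪` the two other factors of the stationary character are trivial
  have hui : ‖u⁻¹‖ = 1 := by rw [norm_inv, hu, inv_one]
  have htriv : ∀ t ∈ fracIdeal ϖ m, quadChar ψ a b (ϖ ^ n * t) = 1 := by
    intro t ht
    have h1 := hstat t (fracIdeal_anti hϖ (by omega) ht)
    rw [hm.eq_one _ ((mul_mem_fracIdeal_iff_of_norm_eq_one hui).2 ht), mul_one, hψ.eq_one,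
      mul_one] at h1
    · exact h1
    · have h2 := mul_mem_fracIdeal hϖ (mul_mem_fracIdeal hϖ ha
        (mul_mem_fracIdeal hϖ (zpow_mem_fracIdeal n) (mem_fracIdeal_zero.2 hu.le)))
        (mul_mem_fracIdeal hϖ (zpow_mem_fracIdeal n) ht)
      exact fracIdeal_anti hϖ (by omega) h2
  -- `u ↦ (1 + t) u` multiplies the integrand on the shell `n'` by `χ (1 + t) ≠ 1`
  obtain ⟨t, ht, hw, hχt⟩ := hm.exists_ne_one
  have key : ∀ v, shellFun ψ χ ϖ a b n' ((1 + t) * v) =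
      unitChar χ (1 + t) * shellFun ψ χ ϖ a b n' v := by
    intro v
    simp only [shellFun]
    rw [unitChar_mul hw]
    by_cases hv : ‖v‖ = 1
    · have h1 : ϖ ^ n' * ((1 + t) * v) = ϖ ^ n' * v + ϖ ^ n * (ϖ ^ (n' - n) * (v * t)) := by
        rw [← mul_assoc (ϖ ^ n), ← zpow_add₀ hϖ.ne_zero]
        ring_nf
      have hvt : v * t ∈ fracIdeal ϖ (m - 1) := (mul_mem_fracIdeal_iff_of_norm_eq_one hv).2 ht
      have hmem : ϖ ^ (n' - n) * (v * t) ∈ fracIdeal ϖ m :=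
        fracIdeal_anti hϖ (by omega) (mul_mem_fracIdeal hϖ (zpow_mem_fracIdeal _) hvt)
      have h2 : ψ (a * (ϖ ^ n' * v) * (ϖ ^ n * (ϖ ^ (n' - n) * (v * t)))) = 1 := by
        apply hψ.eq_one
        have h3 := mul_mem_fracIdeal hϖ (mul_mem_fracIdeal hϖ ha
          (mul_mem_fracIdeal hϖ (zpow_mem_fracIdeal n') (mem_fracIdeal_zero.2 hv.le)))
          (mul_mem_fracIdeal hϖ (zpow_mem_fracIdeal n) hmem)
        exact fracIdeal_anti hϖ (by omega) h3
      rw [h1, quadChar_add, htriv _ hmem, h2]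
      ring
    · rw [unitChar_of_norm_ne hv]
      simp
  have h1 := integral_comp_unit_mul (μ := μ) (shellFun ψ χ ϖ a b n') hw
  simp only [key, integral_const_mul] at h1
  by_contra hne
  exact hχt (mul_right_cancel₀ hne (by rw [one_mul]; exact h1))

end ShellCoeff

/-! ### Gauss sums and the functional equation -/

section FunctionalEquation

variable {L : Type*} [NormedField L] [MeasurableSpace L]

/-- The Gauss sum `∫ χ(w)⁻¹ ψ(x w) dw` over the units `w` of the ring of integers. -/
noncomputable def gaussSumAt (μ : Measure L) (ψ : AddChar L ℂ) (χ : Lˣ →ₜ* Circle) (x : L) : ℂ :=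
  ∫ w, (starRingEnd ℂ) (unitChar χ w) * ψ (x * w) ∂μ

/-- The quadratic Gauss integral `∫ ψ (a (ϖ ^ n u) ^ 2 / 2) du` over the fractional ideal
`ϖ ^ k 𝒪`. -/
noncomputable def gaussIntegral [IsUltrametricDist L] (μ : Measure L) (ψ : AddChar L ℂ)
    (ϖ a : L) (n k : ℤ) : ℂ :=
  ∫ u, (fracIdeal ϖ k : Set L).indicator (fun u => quadChar ψ a 0 (ϖ ^ n * u)) u ∂μ

variable [BorelSpace L] {μ : Measure L} [μ.IsAddHaarMeasure] [ProperSpace L] [IsUltrametricDist L]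
  {ϖ a b : L} {ψ : AddChar L ℂ} {χ : Lˣ →ₜ* Circle} {m α : ℤ} (hϖ : IsUniformizer ϖ)
  (hψ : IsNormalized ϖ ψ) (hm : IsConductor ϖ χ m)

omit [IsUltrametricDist L] in
theorem gaussSumAt_mul_unit (x : L) {u : L} (hu : ‖u‖ = 1) :
    gaussSumAt μ ψ χ (x * u) = unitChar χ u * gaussSumAt μ ψ χ x := by
  have h1 : gaussSumAt μ ψ χ x =
      (starRingEnd ℂ) (unitChar χ u) * gaussSumAt μ ψ χ (x * u) := by
    unfold gaussSumAt
    rw [← integral_comp_unit_mul (μ := μ) _ hu, ← integral_const_mul]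
    congr 1
    ext w
    rw [unitChar_mul hu, map_mul]
    ring_nf
  rw [h1, ← mul_assoc, Complex.mul_conj, Complex.normSq_eq_norm_sq, norm_unitChar hu]
  simp

include hϖ hψ hm in
/-- Gauss sums of a primitive character are supported on one shell. -/
theorem gaussSumAt_zpow_mul (u : L) :
    gaussSumAt μ ψ χ (ϖ ^ (-m) * u) = unitChar χ u * gaussSumAt μ ψ χ (ϖ ^ (-m)) := by
  by_cases hu : ‖u‖ = 1
  · exact gaussSumAt_mul_unit _ hu
  rw [unitChar_of_norm_ne hu, zero_mul]
  by_cases hu0 : u ∈ fracIdeal ϖ 0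
  · have hu1 : u ∈ fracIdeal ϖ 1 := by
      by_contra h
      exact hu ((norm_eq_one_iff hϖ).2 ⟨hu0, h⟩)
    obtain ⟨t, ht, hw, hχt⟩ := hm.exists_ne_one
    have h1 : gaussSumAt μ ψ χ (ϖ ^ (-m) * u) =
        (starRingEnd ℂ) (unitChar χ (1 + t)) * gaussSumAt μ ψ χ (ϖ ^ (-m) * u) := by
      nth_rewrite 1 [gaussSumAt]
      rw [← integral_comp_unit_mul (μ := μ) _ hw, gaussSumAt, ← integral_const_mul]
      congr 1
      ext w
      rw [unitChar_mul hw, map_mul]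
      by_cases hw' : ‖w‖ = 1
      · have h2 : ψ (ϖ ^ (-m) * u * (w * t)) = 1 := by
          apply hψ.eq_one
          have hwt : w * t ∈ fracIdeal ϖ (m - 1) :=
            (mul_mem_fracIdeal_iff_of_norm_eq_one hw').2 ht
          have h3 := mul_mem_fracIdeal hϖ (mul_mem_fracIdeal hϖ
            (zpow_mem_fracIdeal (ϖ := ϖ) (-m)) hu1) hwt
          exact fracIdeal_anti hϖ (by omega) h3
        have h4 : ϖ ^ (-m) * u * ((1 + t) * w) = ϖ ^ (-m) * u * w + ϖ ^ (-m) * u * (w * t) := by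
          ring
        rw [h4, AddChar.map_add_eq_mul, h2]
        ring
      · rw [unitChar_of_norm_ne hw']
        simp
    by_contra hne
    apply hχt
    have h5 := mul_right_cancel₀ hne ((one_mul _).trans h1)
    simpa using (congrArg (starRingEnd ℂ) h5).symm
  · have hx : ϖ ^ (-m) * u ∉ fracIdeal ϖ (-m) := by
      rwa [zpow_mul_mem_fracIdeal_iff hϖ, sub_self]
    obtain ⟨t, ht, hne1⟩ := hψ.exists_mul_ne_one hϖ hx
    have h1 : gaussSumAt μ ψ χ (ϖ ^ (-m) * u) =
        gaussSumAt μ ψ χ (ϖ ^ (-m) * u) * ψ (ϖ ^ (-m) * u * t) := by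
      nth_rewrite 1 [gaussSumAt]
      rw [← integral_add_right_eq_self _ t, gaussSumAt, ← integral_mul_const]
      congr 1
      ext w
      rw [hm.unitChar_add hϖ _ ht, mul_add, AddChar.map_add_eq_mul]
      ring
    by_contra hne
    exact hne1 (mul_left_cancel₀ hne ((mul_one _).trans h1)).symm

omit [MeasurableSpace L] [BorelSpace L] [ProperSpace L] in
include hϖ in
theorem continuous_indicator_fracIdeal (k : ℤ) {g : L → ℂ} (hg : Continuous g) :
    Continuous ((fracIdeal ϖ k : Set L).indicator g) :=
  hg.indicator (by simp [(isClopen_fracIdeal hϖ k).frontier_eq])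

include hϖ hψ hm in
/-- Integrating the Gauss sums over `ϖ ^ (-m) 𝒪` against `ψ` recovers, by orthogonality, a
positive volume, so they do not all vanish. -/
theorem gaussSumAt_ne_zero : gaussSumAt μ ψ χ (ϖ ^ (-m)) ≠ 0 := by
  intro h0
  let F : L → L → ℂ := fun r w => (fracIdeal ϖ 0 : Set L).indicator (fun _ => (1 : ℂ)) r *
    ((starRingEnd ℂ) (unitChar χ w) * ψ (ϖ ^ (-m) * r * (w - 1)))
  have hψc := hψ.continuous hϖ
  have hχc := hm.continuous_unitChar hϖ
  have hF : Continuous F.uncurry := by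
    have h1 := continuous_indicator_fracIdeal hϖ 0 (continuous_const (y := (1 : ℂ)))
    have h2 : Continuous fun w => (starRingEnd ℂ) (unitChar χ w) := Complex.continuous_conj.comp hχc
    exact (h1.comp continuous_fst).mul ((h2.comp continuous_snd).mul (hψc.comp (by fun_prop)))
  have hFc : HasCompactSupport F.uncurry := by
    refine HasCompactSupport.intro ((isCompact_fracIdeal (ϖ := ϖ) 0).prod
      (isCompact_fracIdeal (ϖ := ϖ) 0)) ?_
    rintro ⟨r, w⟩ hrw
    by_contra hne
    refine hrw ⟨?_, ?_⟩
    · by_contra hr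
      exact left_ne_zero_of_mul hne (Set.indicator_of_notMem hr _)
    · by_contra hw
      apply left_ne_zero_of_mul (right_ne_zero_of_mul hne)
      have : unitChar χ w = 0 := unitChar_of_norm_ne fun h => hw ((norm_eq_one_iff hϖ).1 h).1
      simp [this]
  have hswap := integral_integral_swap_of_hasCompactSupport hF hFc (μ := μ) (ν := μ)
  have hl : ∀ r, ∫ w, F r w ∂μ = 0 := by
    intro r
    have h1 : ∀ w, F r w = (fracIdeal ϖ 0 : Set L).indicator (fun _ => (1 : ℂ)) r *
        ψ (-(ϖ ^ (-m) * r)) * ((starRingEnd ℂ) (unitChar χ w) * ψ (ϖ ^ (-m) * r * w)) := by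
      intro w
      have h2 : ϖ ^ (-m) * r * (w - 1) = -(ϖ ^ (-m) * r) + ϖ ^ (-m) * r * w := by ring
      simp only [F]
      rw [h2, AddChar.map_add_eq_mul]
      ring
    have h3 := gaussSumAt_zpow_mul (μ := μ) hϖ hψ hm r
    rw [h0, mul_zero, gaussSumAt] at h3
    simp only [h1]
    rw [integral_const_mul, h3, mul_zero]
  have hr : ∀ w, ∫ r, F r w ∂μ = ((fun w => 1 + w) '' (fracIdeal ϖ m : Set L)).indicator
      (fun _ => (μ.real (fracIdeal ϖ 0 : Set L) : ℂ)) w := by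
    intro w
    have h1 : ∀ r, F r w = (starRingEnd ℂ) (unitChar χ w) * (fracIdeal ϖ 0 : Set L).indicator
        (fun r => ψ (ϖ ^ (-m) * (w - 1) * r)) r := by
      intro r
      by_cases hr : r ∈ (fracIdeal ϖ 0 : Set L)
      · simp only [F, Set.indicator_of_mem hr]
        ring_nf
      · simp only [F, Set.indicator_of_notMem hr]
        ring
    simp only [h1]
    rw [integral_const_mul, integral_indicator (isClopen_fracIdeal hϖ 0).isOpen.measurableSet]
    by_cases hw : w - 1 ∈ fracIdeal ϖ m
    · have hw' : w ∈ (fun w => 1 + w) '' (fracIdeal ϖ m : Set L) := ⟨w - 1, hw, by simp⟩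
      have hχw : unitChar χ w = 1 := by simpa using hm.eq_one _ hw
      rw [Set.indicator_of_mem hw', hχw, setIntegral_congr_fun (g := fun _ => (1 : ℂ))
        (isClopen_fracIdeal hϖ 0).isOpen.measurableSet]
      · simp
      · intro r hr
        apply hψ.eq_one
        have h3 := mul_mem_fracIdeal hϖ (mul_mem_fracIdeal hϖ
            (zpow_mem_fracIdeal (ϖ := ϖ) (-m)) hw) hr
        exact fracIdeal_anti hϖ (by omega) h3
    · have hw' : w ∉ (fun w => 1 + w) '' (fracIdeal ϖ m : Set L) := by
        rintro ⟨y, hy, rfl⟩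
        exact hw (by simpa using hy)
      have hx : ϖ ^ (-m) * (w - 1) ∉ fracIdeal ϖ (-0) := by
        rw [zpow_mul_mem_fracIdeal_iff hϖ]
        simpa using hw
      obtain ⟨t, ht, hne⟩ := hψ.exists_mul_ne_one hϖ hx
      rw [Set.indicator_of_notMem hw', setIntegral_eq_zero_of_nontrivial μ
        (isClopen_fracIdeal hϖ 0).isOpen.measurableSet ?_ ht hne, mul_zero]
      intro x _ y _
      rw [mul_add, AddChar.map_add_eq_mul]
  have hopen : IsOpen ((fun w => 1 + w) '' (fracIdeal ϖ m : Set L)) :=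
    (isOpenMap_add_left (1 : L)) _ (isClopen_fracIdeal hϖ m).isOpen
  have hcomp : IsCompact ((fun w => 1 + w) '' (fracIdeal ϖ m : Set L)) :=
    (isCompact_fracIdeal m).image (by fun_prop)
  simp only [hl, hr, integral_zero] at hswap
  rw [integral_indicator_const _ hopen.measurableSet] at hswap
  have hp1 : μ.real ((fun w => 1 + w) '' (fracIdeal ϖ m : Set L)) ≠ 0 :=
    (ENNReal.toReal_pos (hopen.measure_pos μ ⟨1, 0, zero_mem _, by simp⟩).ne'
      hcomp.measure_lt_top.ne).ne'
  have hp2 : μ.real (fracIdeal ϖ 0 : Set L) ≠ 0 :=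
    (ENNReal.toReal_pos ((isClopen_fracIdeal hϖ 0).isOpen.measure_pos μ ⟨0, zero_mem _⟩).ne'
      (isCompact_fracIdeal 0).measure_lt_top.ne).ne'
  rw [eq_comm, smul_eq_zero] at hswap
  rcases hswap with h | h
  · exact hp1 h
  · exact hp2 (by exact_mod_cast h)

variable [CharZero L]

include hϖ hψ hm in
/-- The functional equation on shells, up to a factor of modulus one: the shell coefficient is
rewritten through the Fourier expansion of `χ` in Gauss sums, and completing the square leaves a
quadratic Gauss integral and the complex conjugate of another shell coefficient. -/
theorem norm_shellCoeff_mul_gaussSumAt (ha : a ≠ 0) (hα : ‖a‖ = ‖ϖ‖ ^ α) (n : ℤ) :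
    ∃ K : ℤ, ∀ k ≤ K, ‖shellCoeff μ ψ χ ϖ a b n‖ * ‖gaussSumAt μ ψ χ (ϖ ^ (-m))‖ =
      ‖gaussIntegral μ ψ ϖ a n k‖ * ‖shellCoeff μ ψ χ ϖ a b (-m - n - α)‖ := by
  have hϖ0 := hϖ.ne_zero
  obtain ⟨k₁, hk₁⟩ := exists_mem_fracIdeal hϖ (b / (a * ϖ ^ n))
  obtain ⟨k₂, hk₂⟩ := exists_mem_fracIdeal hϖ (ϖ ^ (-m) / (a * ϖ ^ n * ϖ ^ n))
  -- for such `k` the translation `h` completing the square below lies in `ϖ ^ k 𝒪`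
  refine ⟨min 0 (min k₁ k₂), fun k hk => ?_⟩
  have hχc := hm.continuous_unitChar hϖ
  have hψc := hψ.continuous hϖ
  have hqc := hψ.continuous_quadChar hϖ a b
  let I : L → ℂ := (fracIdeal ϖ k : Set L).indicator (fun _ => (1 : ℂ))
  let F : L → L → ℂ := fun u w => I u *
    quadChar ψ a b (ϖ ^ n * u) * ((starRingEnd ℂ) (unitChar χ w) * ψ (ϖ ^ (-m) * u * w))
  have hF : Continuous F.uncurry := by
    have h1 : Continuous I := continuous_indicator_fracIdeal hϖ k (continuous_const (y := (1 : ℂ)))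
    have h2 : Continuous fun w => (starRingEnd ℂ) (unitChar χ w) := Complex.continuous_conj.comp hχc
    exact ((h1.comp continuous_fst).mul (hqc.comp (by fun_prop))).mul
      ((h2.comp continuous_snd).mul (hψc.comp (by fun_prop)))
  have hFc : HasCompactSupport F.uncurry := by
    refine HasCompactSupport.intro ((isCompact_fracIdeal (ϖ := ϖ) k).prod
      (isCompact_fracIdeal (ϖ := ϖ) 0)) ?_
    rintro ⟨r, w⟩ hrw
    by_contra hne
    refine hrw ⟨?_, ?_⟩
    · by_contra hr
      exact left_ne_zero_of_mul (left_ne_zero_of_mul hne) (Set.indicator_of_notMem hr _)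
    · by_contra hw
      apply left_ne_zero_of_mul (right_ne_zero_of_mul hne)
      have : unitChar χ w = 0 := unitChar_of_norm_ne fun h => hw ((norm_eq_one_iff hϖ).1 h).1
      simp [this]
  have hswap := integral_integral_swap_of_hasCompactSupport hF hFc (μ := μ) (ν := μ)
  have hl : ∀ u, ∫ w, F u w ∂μ =
      shellFun ψ χ ϖ a b n u * gaussSumAt μ ψ χ (ϖ ^ (-m)) := by
    intro u
    simp only [F]
    rw [integral_const_mul]
    have h1 := gaussSumAt_zpow_mul (μ := μ) hϖ hψ hm u
    rw [gaussSumAt] at h1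
    rw [h1, shellFun]
    by_cases hu : ‖u‖ = 1
    · have : u ∈ (fracIdeal ϖ k : Set L) :=
        fracIdeal_anti hϖ (by omega) (mem_fracIdeal_zero (ϖ := ϖ).2 hu.le)
      simp only [I, Set.indicator_of_mem this]
      ring
    · rw [unitChar_of_norm_ne hu]
      ring
  have hr : ∀ w, ∫ u, F u w ∂μ = gaussIntegral μ ψ ϖ a n k * ψ (-(b ^ 2 / (2 * a))) *
      (starRingEnd ℂ) (quadChar ψ a b (ϖ ^ (-m - n) * a⁻¹ * w) * unitChar χ w) := by
    intro w
    by_cases hw : ‖w‖ = 1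
    · set h := b / (a * ϖ ^ n) + ϖ ^ (-m) / (a * ϖ ^ n * ϖ ^ n) * w with hh
      have hhk : h ∈ fracIdeal ϖ k := by
        refine add_mem (fracIdeal_anti hϖ (by omega) hk₁) ?_
        rw [mul_comm, mul_mem_fracIdeal_iff_of_norm_eq_one hw]
        exact fracIdeal_anti hϖ (by omega) hk₂
      have h1 : ∀ u, F u w = (fracIdeal ϖ k : Set L).indicator
          (fun u => quadChar ψ a 0 (ϖ ^ n * u)) (u + h) * (ψ (-(b ^ 2 / (2 * a))) *
          (starRingEnd ℂ) (quadChar ψ a b (ϖ ^ (-m - n) * a⁻¹ * w) * unitChar χ w)) := by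
        intro u
        by_cases hu : u ∈ (fracIdeal ϖ k : Set L)
        · have hu' : u + h ∈ (fracIdeal ϖ k : Set L) := add_mem hu hhk
          simp only [F, I, Set.indicator_of_mem hu, Set.indicator_of_mem hu']
          rw [map_mul (starRingEnd ℂ)]
          simp only [quadChar]
          rw [conj_addChar hψ.norm_eq_one]
          have h2 : ψ (a / 2 * (ϖ ^ n * u) ^ 2 + b * (ϖ ^ n * u)) * ψ (ϖ ^ (-m) * u * w) =
              ψ (a / 2 * (ϖ ^ n * (u + h)) ^ 2 + 0 * (ϖ ^ n * (u + h))) *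
              (ψ (-(b ^ 2 / (2 * a))) * ψ (-(a / 2 * (ϖ ^ (-m - n) * a⁻¹ * w) ^ 2 +
                b * (ϖ ^ (-m - n) * a⁻¹ * w)))) := by
            simp only [← AddChar.map_add_eq_mul]
            congr 1
            rw [hh, zpow_sub₀ hϖ0]
            field_simp
            ring
          linear_combination (starRingEnd ℂ) (unitChar χ w) * h2
        · have hu' : u + h ∉ (fracIdeal ϖ k : Set L) := fun h' =>
            hu ((AddSubgroup.add_mem_cancel_right _ hhk).1 h')
          simp only [F, I, Set.indicator_of_notMem hu, Set.indicator_of_notMem hu']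
          ring
      simp only [h1]
      rw [integral_mul_const, integral_add_right_eq_self _ h, gaussIntegral]
      ring
    · simp only [F, unitChar_of_norm_ne hw]
      simp
  simp only [hl, hr] at hswap
  rw [integral_mul_const, integral_const_mul, integral_conj] at hswap
  -- the unit `a * ϖ ^ (-α)` is absorbed by a change of variables
  have hunit : ‖a * ϖ ^ (-α)‖ = 1 := by
    rw [norm_mul, norm_zpow, hα, ← zpow_add₀ hϖ.norm_pos.ne']
    simp
  have hfinal : ∫ w, quadChar ψ a b (ϖ ^ (-m - n) * a⁻¹ * w) * unitChar χ w ∂μ =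
      unitChar χ (a * ϖ ^ (-α)) * shellCoeff μ ψ χ ϖ a b (-m - n - α) := by
    rw [← integral_comp_unit_mul (μ := μ) _ hunit, shellCoeff, ← integral_const_mul]
    congr 1
    ext w
    rw [unitChar_mul hunit, shellFun]
    have h1 : ϖ ^ (-m - n) * a⁻¹ * (a * ϖ ^ (-α) * w) = ϖ ^ (-m - n - α) * w := by
      rw [zpow_sub₀ hϖ0 (-m - n), zpow_neg]
      field_simp
    rw [h1]
    ring
  rw [hfinal] at hswap
  have hnorm := congrArg norm hswap
  simp only [norm_mul, RCLike.norm_conj, norm_unitChar hunit, hψ.norm_eq_one, mul_one,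
    one_mul] at hnorm
  exact hnorm

omit [CharZero L] in
theorem gaussIntegral_scale {c : Lˣ} (hc : IsUniformizer (c : L)) (n k : ℤ) :
    (normAbs c : ℂ) ^ n * gaussIntegral μ ψ (c : L) a n k = gaussIntegral μ ψ c a 0 (k + n) := by
  have h := integral_comp_units_mul μ (c ^ n)
    ((fracIdeal (c : L) (k + n) : Set L).indicator
      (fun u => quadChar ψ a 0 ((c : L) ^ (0 : ℤ) * u)))
  have h1 : (normAbs (c ^ n) : ℂ) = (normAbs c : ℂ) ^ n := by simp [normAbs]
  rw [h1] at h
  rw [gaussIntegral, gaussIntegral, ← h]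
  congr 2
  ext u
  have hmem : ((c ^ n : Lˣ) : L) * u ∈ (fracIdeal (c : L) (k + n) : Set L) ↔
      u ∈ (fracIdeal (c : L) k : Set L) := by
    simp only [SetLike.mem_coe, Units.val_zpow_eq_zpow_val]
    rw [zpow_mul_mem_fracIdeal_iff hc]
    simp
  by_cases hu : u ∈ (fracIdeal (c : L) k : Set L)
  · rw [Set.indicator_of_mem hu, Set.indicator_of_mem (hmem.2 hu)]
    simp
  · rw [Set.indicator_of_notMem hu, Set.indicator_of_notMem (fun h => hu (hmem.1 h))]

/-- The symmetry of the shell coefficients about the centre `-(α + m) / 2`. -/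
theorem norm_sq_shellCoeff {c : Lˣ} (hc : IsUniformizer (c : L)) (hψ : IsNormalized (c : L) ψ)
    (hm : IsConductor (c : L) χ m) (ha : a ≠ 0) (hα : ‖a‖ = ‖(c : L)‖ ^ α) (n : ℤ) :
    ‖shellCoeff μ ψ χ c a b n‖ ^ 2 * normAbs c ^ n =
      ‖shellCoeff μ ψ χ c a b (-m - n - α)‖ ^ 2 * normAbs c ^ (-m - n - α) := by
  set n' := -m - n - α with hn'
  obtain ⟨K, hK⟩ := norm_shellCoeff_mul_gaussSumAt (μ := μ) (b := b) hc hψ hm ha hα n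
  obtain ⟨K', hK'⟩ := norm_shellCoeff_mul_gaussSumAt (μ := μ) (b := b) hc hψ hm ha hα n'
  have hnn : -m - n' - α = n := by omega
  rw [hnn] at hK'
  set M := min (K + n) (K' + n')
  have h1 := hK (M - n) (by omega)
  have h2 := hK' (M - n') (by omega)
  have hr := normAbs_pos c
  have e1 := congrArg norm (gaussIntegral_scale (μ := μ) (ψ := ψ) (a := a) hc n (M - n))
  have e2 := congrArg norm (gaussIntegral_scale (μ := μ) (ψ := ψ) (a := a) hc n' (M - n'))
  rw [sub_add_cancel, norm_mul, norm_zpow, Complex.norm_real, Real.norm_of_nonneg hr.le] at e1 e2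
  have hG := norm_pos_iff.2 (gaussSumAt_ne_zero (μ := μ) hc hψ hm)
  set G := ‖gaussSumAt μ ψ χ ((c : L) ^ (-m))‖
  set Γ := ‖gaussIntegral μ ψ (c : L) a 0 M‖
  set x := ‖shellCoeff μ ψ χ c a b n‖
  set y := ‖shellCoeff μ ψ χ c a b n'‖
  set g := ‖gaussIntegral μ ψ (c : L) a n (M - n)‖
  set g' := ‖gaussIntegral μ ψ (c : L) a n' (M - n')‖
  have hR : 0 < normAbs c ^ n := zpow_pos hr _
  have hR' : 0 < normAbs c ^ n' := zpow_pos hr _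
  set R := normAbs c ^ n
  set R' := normAbs c ^ n'
  -- `x R G = Γ y` and `y R' G = Γ x`
  have f1 : x * R * G = Γ * y := by rw [← e1]; linear_combination R * h1
  have f2 : y * R' * G = Γ * x := by rw [← e2]; linear_combination R' * h2
  apply mul_right_cancel₀ hG.ne'
  linear_combination x * f1 - y * f2

end FunctionalEquation

/-! ### The multiplicative group -/

section Units

variable {L : Type*} [NormedField L]

instance instBorelSpaceUnits [MeasurableSpace L] [BorelSpace L] : BorelSpace Lˣ :=
  ⟨by rw [Units.isEmbedding_val₀.eq_induced, borel_comap, ← BorelSpace.measurable_eq (α := L)]; rfl⟩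

variable {c : Lˣ} (hc : IsUniformizer (c : L))

/-- The valuation of `x`, normalized by a uniformizer `c`. -/
noncomputable def unitOrd (hc : IsUniformizer (c : L)) (x : Lˣ) : ℤ :=
  Classical.choose (hc.exists_zpow x x.ne_zero)

theorem norm_eq_zpow_unitOrd (x : Lˣ) : ‖(x : L)‖ = ‖(c : L)‖ ^ unitOrd hc x :=
  Classical.choose_spec (hc.exists_zpow x x.ne_zero)

theorem unitOrd_eq_iff {x : Lˣ} {n : ℤ} : unitOrd hc x = n ↔ ‖(x : L)‖ = ‖(c : L)‖ ^ n := by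
  rw [norm_eq_zpow_unitOrd hc, hc.zpow_norm_inj]

theorem unitOrd_mul (x y : Lˣ) : unitOrd hc (x * y) = unitOrd hc x + unitOrd hc y := by
  rw [unitOrd_eq_iff, Units.val_mul, norm_mul, zpow_add₀ hc.norm_pos.ne',
    norm_eq_zpow_unitOrd hc x, norm_eq_zpow_unitOrd hc y]

theorem unitOrd_zpow (n : ℤ) : unitOrd hc (c ^ n) = n := by
  rw [unitOrd_eq_iff, Units.val_zpow_eq_zpow_val, norm_zpow]

theorem unitOrd_inv (x : Lˣ) : unitOrd hc x⁻¹ = -unitOrd hc x := by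
  rw [unitOrd_eq_iff, Units.val_inv_eq_inv_val, norm_inv, zpow_neg, norm_eq_zpow_unitOrd hc x]

theorem unitOrd_eq_zero_iff {x : Lˣ} : unitOrd hc x = 0 ↔ ‖(x : L)‖ = 1 := by
  rw [unitOrd_eq_iff, zpow_zero]

theorem coe_mem_fracIdeal_iff [IsUltrametricDist L] {x : Lˣ} {k : ℤ} :
    (x : L) ∈ fracIdeal (c : L) k ↔ k ≤ unitOrd hc x := by
  rw [mem_fracIdeal, norm_eq_zpow_unitOrd hc, hc.zpow_norm_le_iff]

/-- The elements of valuation `n`. -/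
def unitShell (hc : IsUniformizer (c : L)) (n : ℤ) : Set Lˣ := {x | unitOrd hc x = n}

theorem mem_unitShell {hc : IsUniformizer (c : L)} {x : Lˣ} {n : ℤ} :
    x ∈ unitShell hc n ↔ unitOrd hc x = n := Iff.rfl

variable [IsUltrametricDist L]

theorem continuous_unitOrd : Continuous (unitOrd hc) := by
  refine continuous_discrete_rng.2 fun n => ?_
  have : unitOrd hc ⁻¹' {n} = Units.val ⁻¹' Metric.sphere (0 : L) (‖(c : L)‖ ^ n) := by
    ext x
    simp [unitOrd_eq_iff]
  rw [this]
  exact (IsUltrametricDist.isOpen_sphere _ (zpow_pos hc.norm_pos n).ne').preimage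
    Units.continuous_val

theorem isClopen_unitShell (n : ℤ) : IsClopen (unitShell hc n) :=
  (isClopen_discrete {n}).preimage (continuous_unitOrd hc)

omit [IsUltrametricDist L] in
theorem isCompact_unitShell [ProperSpace L] (n : ℤ) : IsCompact (unitShell hc n) := by
  rw [Units.isEmbedding_val₀.isCompact_iff]
  have : Units.val '' (unitShell hc n) = Metric.sphere (0 : L) (‖(c : L)‖ ^ n) := by
    ext x
    simp only [Set.mem_image, mem_unitShell, unitOrd_eq_iff, mem_sphere_zero_iff_norm]
    constructor
    · rintro ⟨y, hy, rfl⟩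
      exact hy
    · intro hx
      have hx0 : x ≠ 0 := by
        rintro rfl
        rw [norm_zero] at hx
        exact (zpow_pos hc.norm_pos n).ne hx
      exact ⟨Units.mk0 x hx0, hx, rfl⟩
  rw [this]
  exact isCompact_sphere _ _

include hc in
/-- The higher unit groups `1 + ϖ ^ N 𝒪` form a neighbourhood basis of `1`. -/
theorem exists_higherUnits_subset {s : Set Lˣ} (hs : s ∈ nhds (1 : Lˣ)) :
    ∃ N : ℤ, 1 ≤ N ∧ ∀ k : Lˣ, (k : L) - 1 ∈ fracIdeal (c : L) N → k ∈ s := by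
  rw [Units.isEmbedding_val₀.nhds_eq_comap, Filter.mem_comap] at hs
  obtain ⟨t, ht, hts⟩ := hs
  have h0 : (fun x : L => 1 + x) ⁻¹' t ∈ nhds (0 : L) := by
    apply (continuous_const.add continuous_id).continuousAt
    simpa using ht
  obtain ⟨k, hk⟩ := exists_fracIdeal_subset hc h0
  refine ⟨max 1 k, by omega, fun u hu => hts ?_⟩
  have := hk (fracIdeal_anti hc (le_max_right _ _) hu)
  simpa using this

include hc in
theorem inv_sub_one_mem {N : ℤ} (hN : 1 ≤ N) {k : Lˣ} (hk : (k : L) - 1 ∈ fracIdeal (c : L) N) :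
    ((k⁻¹ : Lˣ) : L) - 1 ∈ fracIdeal (c : L) N := by
  have h1 : ‖(k : L)‖ = 1 := by
    have := (norm_add_eq_one_iff hc (x := 1) (fracIdeal_anti hc hN hk)).2 norm_one
    simpa using this
  have h2 : ((k⁻¹ : Lˣ) : L) - 1 = -((k : L)⁻¹ * ((k : L) - 1)) := by
    rw [Units.val_inv_eq_inv_val]
    have := k.ne_zero
    field_simp
    ring
  rw [h2]
  refine neg_mem ((mul_mem_fracIdeal_iff_of_norm_eq_one ?_).2 hk)
  rw [norm_inv, h1, inv_one]

include hc in
theorem continuous_of_mul_higherUnits {X : Type*} [TopologicalSpace X] {g : Lˣ → X} (N : ℤ)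
    (hg : ∀ x k : Lˣ, (k : L) - 1 ∈ fracIdeal (c : L) N → g (x * k) = g x) : Continuous g := by
  refine continuous_iff_continuousAt.2 fun x => ?_
  refine ContinuousAt.congr (f := fun _ => g x) continuousAt_const ?_
  have hopen : IsOpen
      ((fun y : Lˣ => ((x⁻¹ * y : Lˣ) : L) - 1) ⁻¹' (fracIdeal (c : L) N : Set L)) :=
    (isClopen_fracIdeal hc N).isOpen.preimage
      ((Units.continuous_val.comp (continuous_const.mul continuous_id)).sub continuous_const)
  filter_upwards [hopen.mem_nhds (by simp)] with y hy
  rw [← hg x _ hy]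
  simp

include hc in
/-- A locally constant function of compact support is invariant under a higher unit group. -/
theorem exists_higherUnits_invariant {φ : Lˣ → ℂ} (hφ : IsLocallyConstant φ)
    (hφc : HasCompactSupport φ) : ∃ N : ℤ, 1 ≤ N ∧
      ∀ x k : Lˣ, (k : L) - 1 ∈ fracIdeal (c : L) N → φ (x * k) = φ x := by
  have hopen : IsOpen {z : Lˣ × Lˣ | φ (z.1 * z.2) = φ z.1} := by
    have h : IsLocallyConstant fun z : Lˣ × Lˣ => φ (z.1 * z.2) - φ z.1 :=
      (hφ.comp_continuous continuous_mul).sub (hφ.comp_continuous continuous_fst)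
    convert h.isOpen_fiber 0 using 1
    ext z
    simp [sub_eq_zero]
  obtain ⟨u, v, -, hv, hu, h1v, huv⟩ := generalized_tube_lemma hφc.isCompact
    (isCompact_singleton (x := (1 : Lˣ))) hopen (by rintro ⟨x, y⟩ ⟨-, rfl⟩; simp)
  obtain ⟨N, hN, hNv⟩ := exists_higherUnits_subset hc (hv.mem_nhds (h1v rfl))
  refine ⟨N, hN, fun x k hk => ?_⟩
  by_cases hx : x ∈ tsupport φ
  · exact huv (Set.mk_mem_prod (hu hx) (hNv k hk))
  by_cases hxk : x * k ∈ tsupport φ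
  · have : φ (x * k * k⁻¹) = φ (x * k) :=
      huv (Set.mk_mem_prod (hu hxk) (hNv _ (inv_sub_one_mem hc hN hk)))
    rw [← this, mul_inv_cancel_right]
  · rw [image_eq_zero_of_notMem_tsupport hx, image_eq_zero_of_notMem_tsupport hxk]

/-- The circle has no small subgroups: squaring moves a point close to `1` away from `1` by a
factor at least `3 / 2`. -/
theorem eq_one_of_norm_pow_sub_one_le {z : ℂ} (h : ∀ n : ℕ, ‖z ^ n - 1‖ ≤ 1 / 2) : z = 1 := by
  have hstep : ∀ k : ℕ, (3 / 2 : ℝ) ^ k * ‖z - 1‖ ≤ ‖z ^ (2 ^ k) - 1‖ := by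
    intro k
    induction k with
    | zero => simp
    | succ k ih =>
      set w := z ^ (2 ^ k) with hw
      have h1 : z ^ (2 ^ (k + 1)) - 1 = (w - 1) * (w + 1) := by
        rw [hw, pow_succ, pow_mul]; ring
      have h2 : (3 / 2 : ℝ) ≤ ‖w + 1‖ := by
        have h3 : ‖(2 : ℂ)‖ ≤ ‖w + 1‖ + ‖w - 1‖ := by
          have := norm_sub_le (w + 1) (w - 1)
          rwa [show w + 1 - (w - 1) = 2 by ring] at this
        have h4 := h (2 ^ k)
        rw [Complex.norm_ofNat] at h3
        linarith
      rw [h1, norm_mul, pow_succ]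
      calc (3 / 2 : ℝ) ^ k * (3 / 2) * ‖z - 1‖ = (3 / 2 : ℝ) ^ k * ‖z - 1‖ * (3 / 2) := by ring
        _ ≤ ‖w - 1‖ * ‖w + 1‖ := by gcongr
  by_contra hne
  have hpos : 0 < ‖z - 1‖ := norm_pos_iff.2 (sub_ne_zero.2 hne)
  obtain ⟨k, hk⟩ := pow_unbounded_of_one_lt (1 / ‖z - 1‖) (show (1 : ℝ) < 3 / 2 by norm_num)
  have h1 := (hstep k).trans (h _)
  rw [div_lt_iff₀ hpos] at hk
  linarith

include hc in
theorem sub_one_mem_pow {N : ℤ} (hN : 1 ≤ N) {k : Lˣ} (hk : (k : L) - 1 ∈ fracIdeal (c : L) N)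
    (n : ℕ) : ((k ^ n : Lˣ) : L) - 1 ∈ fracIdeal (c : L) N := by
  have h1 : ‖(k : L)‖ = 1 := by
    have := (norm_add_eq_one_iff hc (x := 1) (fracIdeal_anti hc hN hk)).2 norm_one
    simpa using this
  induction n with
  | zero => simp
  | succ n ih =>
    have h2 : ((k ^ (n + 1) : Lˣ) : L) - 1 =
        (k : L) * (((k ^ n : Lˣ) : L) - 1) + ((k : L) - 1) := by
      push_cast
      ring
    rw [h2]
    exact add_mem ((mul_mem_fracIdeal_iff_of_norm_eq_one h1).2 ih) hk

include hc in
/-- A ramified continuous unitary character has a conductor. -/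
theorem exists_isConductor {χ : Lˣ →ₜ* Circle} (hχ : IsRamified χ) :
    ∃ m : ℤ, IsConductor (c : L) χ m := by
  classical
  have hopen : {x : Lˣ | ‖(χ x : ℂ) - 1‖ < 1 / 2} ∈ nhds (1 : Lˣ) := by
    have hcont : Continuous fun x : Lˣ => ‖(χ x : ℂ) - 1‖ :=
      ((continuous_induced_dom.comp χ.continuous).sub continuous_const).norm
    exact (isOpen_lt hcont continuous_const).mem_nhds (by simp)
  obtain ⟨N, hN1, hN⟩ := exists_higherUnits_subset hc hopen
  have htriv : ∀ k : Lˣ, (k : L) - 1 ∈ fracIdeal (c : L) N → (χ k : ℂ) = 1 := by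
    intro k hk
    refine eq_one_of_norm_pow_sub_one_le fun n => ?_
    have := hN _ (sub_one_mem_pow hc hN1 hk n)
    rw [Set.mem_ofPred_eq, map_pow, Circle.coe_pow] at this
    exact this.le
  have hunit : ∀ t ∈ fracIdeal (c : L) 1, ‖1 + t‖ = 1 := fun t ht =>
    (norm_add_eq_one_iff hc ht).2 norm_one
  let P : ℕ → Prop := fun n => ∀ t ∈ fracIdeal (c : L) (n + 1 : ℤ), unitChar χ (1 + t) = 1
  have hP : ∃ n, P n := by
    refine ⟨N.toNat, fun t ht => ?_⟩
    have hu := hunit t (fracIdeal_anti hc (by omega) ht)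
    have hu0 : 1 + t ≠ 0 := norm_ne_zero_iff.1 (hu ▸ one_ne_zero)
    have h1 := unitChar_coe (χ := χ) (u := Units.mk0 _ hu0) hu
    rw [Units.val_mk0] at h1
    rw [h1, htriv]
    rw [Units.val_mk0, add_sub_cancel_left]
    exact fracIdeal_anti hc (by omega) ht
  refine ⟨Nat.find hP + 1, by omega, Nat.find_spec hP, ?_⟩
  rw [add_sub_cancel_right]
  rcases Nat.eq_zero_or_pos (Nat.find hP) with h0 | hpos
  · obtain ⟨u, hu, hχu⟩ := hχ
    refine ⟨(u : L) - 1, ?_, by simpa using hu, ?_⟩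
    · rw [h0]
      exact sub_mem (mem_fracIdeal_zero.2 hu.le) (mem_fracIdeal_zero.2 norm_one.le)
    · rw [add_sub_cancel, unitChar_coe hu]
      intro h
      exact hχu (Circle.ext (by simpa using h))
  · have hmin := Nat.find_min hP (m := Nat.find hP - 1) (by omega)
    simp only [P] at hmin
    push Not at hmin
    obtain ⟨t, ht, hne⟩ := hmin
    have ht' : t ∈ fracIdeal (c : L) (Nat.find hP : ℤ) := by
      have : ((Nat.find hP - 1 : ℕ) : ℤ) + 1 = Nat.find hP := by omega
      rwa [this] at ht
    exact ⟨t, ht', hunit t (fracIdeal_anti hc (by omega) ht'), hne⟩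

variable [ProperSpace L]

omit [IsUltrametricDist L] in
theorem normAbs_eq_zpow_unitOrd [MeasurableSpace L] [BorelSpace L] (x : Lˣ) :
    normAbs x = normAbs c ^ unitOrd hc x := by
  have h1 : normAbs (x * c ^ (-unitOrd hc x)) = 1 := by
    apply normAbs_eq_one
    rw [← unitOrd_eq_zero_iff hc, unitOrd_mul, unitOrd_zpow]
    omega
  have h2 : normAbs (c ^ (-unitOrd hc x)) = normAbs c ^ (-unitOrd hc x) := by simp [normAbs]
  rw [normAbs_mul, h2, zpow_neg] at h1
  exact eq_of_mul_inv_eq_one h1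

theorem ofReal_zpow_cpow {r : ℝ} (hr : 0 < r) (n : ℤ) (s : ℂ) :
    (((r ^ n : ℝ)) : ℂ) ^ s = ((r : ℂ) ^ s) ^ n := by
  have h1 : ((r ^ n : ℝ) : ℂ) ≠ 0 := by exact_mod_cast (zpow_pos hr n).ne'
  have h2 : (r : ℂ) ≠ 0 := by exact_mod_cast hr.ne'
  rw [Complex.cpow_def_of_ne_zero h1, Complex.cpow_def_of_ne_zero h2, ← Complex.ofReal_log
    (zpow_pos hr n).le, ← Complex.ofReal_log hr.le, Real.log_zpow, ← Complex.exp_int_mul]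
  push_cast
  ring_nf

omit [IsUltrametricDist L] in
theorem quasiChar_eq [MeasurableSpace L] [BorelSpace L] (s : ℂ) (χ : Lˣ →ₜ* Circle) (x : Lˣ) :
    quasiChar s χ x = ((normAbs c : ℂ) ^ s) ^ unitOrd hc x * (χ x : ℂ) := by
  rw [quasiChar, normAbs_eq_zpow_unitOrd hc, ofReal_zpow_cpow (normAbs_pos c)]

omit [IsUltrametricDist L] in
theorem quasiChar_mul (s : ℂ) (χ : Lˣ →ₜ* Circle) (x y : Lˣ) :
    quasiChar s χ (x * y) = quasiChar s χ x * quasiChar s χ y := by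
  simp only [quasiChar]
  rw [normAbs_mul, Complex.ofReal_mul,
    Complex.mul_cpow_ofReal_nonneg (normAbs_pos x).le (normAbs_pos y).le, map_mul, Circle.coe_mul]
  ring

include hc in
theorem continuous_quasiChar [MeasurableSpace L] [BorelSpace L] (s : ℂ) (χ : Lˣ →ₜ* Circle) :
    Continuous (quasiChar s χ) := by
  have h : quasiChar s χ = fun x : Lˣ => ((normAbs c : ℂ) ^ s) ^ unitOrd hc x * (χ x : ℂ) :=
    funext (quasiChar_eq hc s χ)
  rw [h]
  exact (continuous_of_discreteTopology.comp (continuous_unitOrd hc)).mul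
    (continuous_induced_dom.comp χ.continuous)

end Units

/-! ### Convolution and shell decomposition of the Mellin transform -/

section Convolution

variable {L : Type*} [NormedField L] [ProperSpace L] [IsUltrametricDist L] [MeasurableSpace L]
  [BorelSpace L] {ν : Measure Lˣ} [ν.IsHaarMeasure] {c : Lˣ} (hc : IsUniformizer (c : L))
  {χ : Lˣ →ₜ* Circle} {φ f : Lˣ → ℂ}

omit [ProperSpace L] [MeasurableSpace L] [BorelSpace L] in
theorem continuous_indicator_unitShell (n : ℤ) {g : Lˣ → ℂ} (hg : Continuous g) :
    Continuous ((unitShell hc n).indicator g) :=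
  hg.indicator (by simp [(isClopen_unitShell hc n).frontier_eq])

omit [ProperSpace L] [ν.IsHaarMeasure] in
theorem hasSum_setIntegral_unitShell {g : Lˣ → ℂ} (hg : Integrable g ν) :
    HasSum (fun n : ℤ => ∫ x in unitShell hc n, g x ∂ν) (∫ x, g x ∂ν) := by
  have hU : (⋃ n : ℤ, unitShell hc n) = Set.univ := by ext x; simp [mem_unitShell]
  have h := hasSum_integral_iUnion (μ := ν) (f := g) (s := fun n : ℤ => unitShell hc n)
    (fun n => (isClopen_unitShell hc n).isOpen.measurableSet)
    (fun i j hij => Set.disjoint_left.2 fun x hi hj => hij (hi.symm.trans hj))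
    (by rw [hU]; exact hg.integrableOn)
  rwa [hU, Measure.restrict_univ] at h

omit [ProperSpace L] [IsUltrametricDist L] [MeasurableSpace L] [BorelSpace L] in
theorem continuous_mulConv_integrand (hφ : Continuous φ) (hf : Continuous f) (y : Lˣ) :
    Continuous fun x => φ x * f (x⁻¹ * y) :=
  hφ.mul (hf.comp (continuous_inv.mul continuous_const))

omit [ProperSpace L] [IsUltrametricDist L] in
theorem integrable_mulConv (hφ : Continuous φ) (hφc : HasCompactSupport φ) (hf : Continuous f)
    (y : Lˣ) : Integrable (fun x => φ x * f (x⁻¹ * y)) ν :=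
  (continuous_mulConv_integrand hφ hf y).integrable_of_hasCompactSupport hφc.mul_right

omit [ProperSpace L] [IsUltrametricDist L] in
theorem mulConv_mul_of_invariant {k : Lˣ} (hk : ∀ x, φ (x * k) = φ x) (y : Lˣ) :
    mulConv ν φ f (y * k) = mulConv ν φ f y := by
  unfold mulConv
  rw [← integral_mul_left_eq_self _ k]
  congr 1
  ext x
  rw [mul_comm k x, hk]
  congr 2
  rw [mul_inv, mul_mul_mul_comm, inv_mul_cancel, mul_one]

/-- Convolution with `φ` mixes the shells only through the shells of `φ`. -/
theorem setIntegral_unitShell_mulConv (hφ : Continuous φ) (hφc : HasCompactSupport φ)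
    (hf : Continuous f) (s : ℂ) (S : Finset ℤ)
    (hS : ∀ n ∉ S, ∫ x in unitShell hc n, f x * quasiChar s χ x ∂ν = 0) (n : ℤ) :
    ∫ y in unitShell hc n, mulConv ν φ f y * quasiChar s χ y ∂ν =
      ∑ k ∈ S, (∫ x in unitShell hc k, f x * quasiChar s χ x ∂ν) *
        ∫ x in unitShell hc (n - k), φ x * quasiChar s χ x ∂ν := by
  set C : ℤ → ℂ := fun k => ∫ x in unitShell hc k, f x * quasiChar s χ x ∂ν with hC
  have hQ := continuous_quasiChar hc s χ
  let F : Lˣ → Lˣ → ℂ := fun y x => φ x * quasiChar s χ x *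
    (unitShell hc n).indicator (fun _ => (1 : ℂ)) y *
      (f (x⁻¹ * y) * quasiChar s χ (x⁻¹ * y))
  have hF : Continuous F.uncurry := by
    have h1 := continuous_indicator_unitShell hc n (continuous_const (y := (1 : ℂ)))
    have h2 : Continuous fun z : Lˣ × Lˣ => z.2⁻¹ * z.1 :=
      (continuous_inv.comp continuous_snd).mul continuous_fst
    exact (((hφ.comp continuous_snd).mul (hQ.comp continuous_snd)).mul
      (h1.comp continuous_fst)).mul ((hf.comp h2).mul (hQ.comp h2))
  have hFc : HasCompactSupport F.uncurry := by
    refine HasCompactSupport.intro ((isCompact_unitShell hc n).prod hφc.isCompact) ?_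
    rintro ⟨y, x⟩ hyx
    by_contra hne
    have h1 := left_ne_zero_of_mul hne
    refine hyx ⟨?_, ?_⟩
    · by_contra hy
      exact right_ne_zero_of_mul h1 (Set.indicator_of_notMem hy _)
    · exact subset_tsupport _ (left_ne_zero_of_mul (left_ne_zero_of_mul h1))
  have hswap := integral_integral_swap_of_hasCompactSupport hF hFc (μ := ν) (ν := ν)
  have hl : ∀ y, ∫ x, F y x ∂ν = (unitShell hc n).indicator
      (fun y => mulConv ν φ f y * quasiChar s χ y) y := by
    intro y
    by_cases hy : unitOrd hc y = n
    · rw [Set.indicator_of_mem (mem_unitShell.2 hy), mulConv, ← integral_mul_const]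
      congr 1
      ext x
      have h1 : quasiChar s χ y = quasiChar s χ x * quasiChar s χ (x⁻¹ * y) := by
        rw [← quasiChar_mul, mul_inv_cancel_left]
      simp only [F]
      rw [Set.indicator_of_mem (mem_unitShell.2 hy), h1]
      ring
    · rw [Set.indicator_of_notMem (mt mem_unitShell.1 hy)]
      simp only [F]
      rw [Set.indicator_of_notMem (mt mem_unitShell.1 hy)]
      simp
  have hr : ∀ x, ∫ y, F y x ∂ν = ∑ k ∈ S, C k *
      (unitShell hc (n - k)).indicator (fun x => φ x * quasiChar s χ x) x := by
    intro x
    have h1 : ∫ y, F y x ∂ν = φ x * quasiChar s χ x * C (n - unitOrd hc x) := by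
      simp only [F, mul_assoc]
      rw [integral_const_mul, integral_const_mul, ← integral_mul_left_eq_self _ x, hC]
      simp only
      rw [← integral_indicator (isClopen_unitShell hc _).isOpen.measurableSet]
      congr 3
      ext y
      by_cases hy : unitOrd hc y = n - unitOrd hc x
      · have hxy : unitOrd hc (x * y) = n := by rw [unitOrd_mul]; omega
        rw [Set.indicator_of_mem (mem_unitShell.2 hy), Set.indicator_of_mem (mem_unitShell.2 hxy),
          inv_mul_cancel_left, one_mul]
      · have hxy : unitOrd hc (x * y) ≠ n := by rw [unitOrd_mul]; omega
        rw [Set.indicator_of_notMem (mt mem_unitShell.1 hy),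
          Set.indicator_of_notMem (mt mem_unitShell.1 hxy), zero_mul]
    rw [h1]
    by_cases hx : n - unitOrd hc x ∈ S
    · rw [Finset.sum_eq_single_of_mem _ hx]
      · rw [Set.indicator_of_mem (by simp [mem_unitShell])]
        ring
      · intro k _ hk
        rw [Set.indicator_of_notMem, mul_zero]
        rw [mem_unitShell]
        omega
    · rw [hC]
      simp only
      rw [hS _ hx, mul_zero, Finset.sum_eq_zero]
      intro k hk
      rw [Set.indicator_of_notMem, mul_zero]
      rw [mem_unitShell]
      rintro h
      exact hx (by rwa [h, sub_sub_cancel])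
  simp only [hl, hr] at hswap
  rw [integral_indicator (isClopen_unitShell hc n).isOpen.measurableSet] at hswap
  rw [hswap, integral_finsetSum]
  · refine Finset.sum_congr rfl fun k _ => ?_
    rw [integral_const_mul, integral_indicator (isClopen_unitShell hc _).isOpen.measurableSet]
  · intro k _
    refine Integrable.const_mul ?_ _
    exact (((hφ.mul hQ).integrable_of_hasCompactSupport hφc.mul_right).indicator
      (isClopen_unitShell hc _).isOpen.measurableSet)

/-- If only the shells in a finite set contribute to the Mellin integral of `f`, their total
contribution is the weak Mellin transform of `f`, as soon as the transforms of the convolutions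
converge. -/
theorem mellinTransform_mulConv (hφ : Continuous φ) (hφc : HasCompactSupport φ)
    (hf : Continuous f) (s : ℂ) (S : Finset ℤ)
    (hS : ∀ n ∉ S, ∫ x in unitShell hc n, f x * quasiChar s χ x ∂ν = 0)
    (hint : MellinWellDefined ν (mulConv ν φ f) s χ) :
    mellinTransform ν (mulConv ν φ f) s χ =
      (∑ k ∈ S, ∫ x in unitShell hc k, f x * quasiChar s χ x ∂ν) *
        mellinTransform ν φ s χ := by
  have h1 := hasSum_setIntegral_unitShell hc hint
  simp only [setIntegral_unitShell_mulConv hc hφ hφc hf s S hS] at h1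
  refine h1.unique ?_
  rw [Finset.sum_mul]
  refine hasSum_sum fun k _ => HasSum.mul_left _ ?_
  have hint' : Integrable (fun x => φ x * quasiChar s χ x) ν :=
    (hφ.mul (continuous_quasiChar hc s χ)).integrable_of_hasCompactSupport hφc.mul_right
  exact (Equiv.subRight k).hasSum_iff.2 (hasSum_setIntegral_unitShell hc hint')

omit [ProperSpace L] [MeasurableSpace L] [BorelSpace L] in
theorem exists_abs_unitOrd_le (hφc : HasCompactSupport φ) :
    ∃ R : ℤ, ∀ x, φ x ≠ 0 → |unitOrd hc x| ≤ R := by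
  have himg : IsCompact ((fun x => |unitOrd hc x|) '' tsupport φ) :=
    hφc.isCompact.image ((continuous_of_discreteTopology (f := fun n : ℤ => |n|)).comp
      (continuous_unitOrd hc))
  obtain ⟨R, hR⟩ := himg.bddAbove
  exact ⟨R, fun x hx => hR ⟨x, subset_tsupport _ hx, rfl⟩⟩

/-- A continuous function on `Lˣ` that is constant near `0` and vanishes near infinity has
a Mellin transform on `Re s > 0`. -/
theorem mellinWellDefined_of_const_of_zero {g : Lˣ → ℂ} (hg : Continuous g) {T₀ T₁ : ℤ} {A : ℂ}
    (h0 : ∀ y, T₁ ≤ unitOrd hc y → g y = A) (h1 : ∀ y, unitOrd hc y ≤ T₀ → g y = 0)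
    {s : ℂ} (hs : 0 < s.re) : MellinWellDefined ν g s χ := by
  have hQ := continuous_quasiChar hc s χ
  have hU : (⋃ n : ℤ, unitShell hc n) = Set.univ := by ext x; simp [mem_unitShell]
  rw [MellinWellDefined, ← integrableOn_univ, ← hU]
  refine integrableOn_iUnion_of_summable_integral_norm
    (fun n => (hg.mul hQ).continuousOn.integrableOn_compact (isCompact_unitShell hc n)) ?_
  have hvol : ∀ n : ℤ, ν.real (unitShell hc n) = ν.real (unitShell hc 0) := by
    intro n
    have : unitShell hc 0 = (fun x => c ^ n * x) ⁻¹' (unitShell hc n) := by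
      ext x
      simp [mem_unitShell, unitOrd_mul, unitOrd_zpow]
    rw [this, measureReal_def, measureReal_def, measure_preimage_mul]
  have hnorm : ∀ y, ‖quasiChar s χ y‖ = (normAbs c ^ s.re) ^ unitOrd hc y := by
    intro y
    rw [quasiChar_eq hc, norm_mul, norm_zpow, Circle.norm_coe, mul_one,
      Complex.norm_cpow_eq_rpow_re_of_pos (normAbs_pos c)]
  set ρ := normAbs c ^ s.re with hρ
  have hρ0 : 0 < ρ := Real.rpow_pos_of_pos (normAbs_pos c) _
  have hρ1 : ρ < 1 := Real.rpow_lt_one (normAbs_pos c).le (normAbs_uniformizer_lt_one hc) hs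
  refine Summable.of_nat_of_neg ?_ ?_
  · refine (summable_nat_add_iff T₁.toNat).1 ?_
    have hsum : Summable fun n : ℕ => ρ ^ n * (ρ ^ T₁.toNat * (‖A‖ *
        ν.real (unitShell hc 0))) :=
      (summable_geometric_of_lt_one hρ0.le hρ1).mul_right _
    refine hsum.congr fun n => ?_
    rw [setIntegral_congr_fun (g := fun _ => ‖A‖ * ρ ^ (n + T₁.toNat))
      (isClopen_unitShell hc _).isOpen.measurableSet]
    · rw [setIntegral_const, hvol (((n + T₁.toNat : ℕ) : ℤ)), smul_eq_mul, pow_add]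
      ring
    · intro y hy
      rw [mem_unitShell] at hy
      simp only
      rw [norm_mul, hnorm, h0 y (by omega), hy, zpow_natCast]
  · refine (summable_nat_add_iff T₀.natAbs).1 ?_
    refine summable_zero.congr fun n => ?_
    rw [setIntegral_congr_fun (g := fun _ => (0 : ℝ))
      (isClopen_unitShell hc _).isOpen.measurableSet]
    · simp
    · intro y hy
      rw [mem_unitShell] at hy
      simp only
      rw [h1 y (by omega), zero_mul, norm_zero]

/-- Integrals over the compact unit group of `𝒪` against a multiplicative and an additive Haar
measure are proportional. -/
theorem integral_units_eq (μ : Measure L) [μ.IsAddHaarMeasure] {g : L → ℂ} (hg : Continuous g)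
    (hsupp : ∀ x, ‖x‖ ≠ 1 → g x = 0) :
    (μ.real (Metric.sphere (0 : L) 1) : ℂ) * ∫ u : Lˣ, g u ∂ν =
      ν.real (unitShell hc 0) * ∫ x, g x ∂μ := by
  have hsph : IsClopen (Metric.sphere (0 : L) 1) := IsUltrametricDist.isClopen_sphere _ one_ne_zero
  let I : L → ℂ := (Metric.sphere (0 : L) 1).indicator fun _ => 1
  let J : Lˣ → ℂ := (unitShell hc 0).indicator fun _ => 1
  let F : L → Lˣ → ℂ := fun w v => I w * J v * g (v * w)
  have hI : Continuous I := continuous_const.indicator (by simp [hsph.frontier_eq])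
  have hJ : Continuous J := continuous_indicator_unitShell hc 0 continuous_const
  have hF : Continuous F.uncurry := by
    refine ((hI.comp continuous_fst).mul (hJ.comp continuous_snd)).mul (hg.comp ?_)
    exact (Units.continuous_val.comp continuous_snd).mul continuous_fst
  have hFc : HasCompactSupport F.uncurry := by
    refine HasCompactSupport.intro ((isCompact_sphere (0 : L) 1).prod (isCompact_unitShell hc 0)) ?_
    rintro ⟨w, v⟩ hwv
    by_contra hne
    have h1 := left_ne_zero_of_mul hne
    refine hwv ⟨?_, ?_⟩
    · by_contra hw
      exact left_ne_zero_of_mul h1 (Set.indicator_of_notMem hw _)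
    · by_contra hv
      exact right_ne_zero_of_mul h1 (Set.indicator_of_notMem hv _)
  have hswap := integral_integral_swap_of_hasCompactSupport hF hFc (μ := μ) (ν := ν)
  have hl : ∀ w, ∫ v, F w v ∂ν = I w * ∫ u : Lˣ, g u ∂ν := by
    intro w
    simp only [F, mul_assoc]
    rw [integral_const_mul]
    by_cases hw : w ∈ Metric.sphere (0 : L) 1
    · have hw1 : ‖w‖ = 1 := by simpa using hw
      have hw0 : w ≠ 0 := norm_ne_zero_iff.1 (hw1 ▸ one_ne_zero)
      congr 1
      rw [← integral_mul_right_eq_self (μ := ν) (fun u : Lˣ => g u) (Units.mk0 w hw0)]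
      congr 1
      ext v
      by_cases hv : unitOrd hc v = 0
      · simp only [J]
        rw [Set.indicator_of_mem (mem_unitShell.2 hv), one_mul]
        simp
      · simp only [J]
        rw [Set.indicator_of_notMem (mt mem_unitShell.1 hv), zero_mul, hsupp]
        rwa [Units.val_mul, norm_mul, Units.val_mk0, hw1, mul_one, Ne, ← unitOrd_eq_zero_iff hc]
    · simp only [I]
      rw [Set.indicator_of_notMem hw, zero_mul, zero_mul]
  have hr : ∀ v, ∫ w, F w v ∂μ = J v * ∫ x, g x ∂μ := by
    intro v
    by_cases hv : unitOrd hc v = 0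
    · have hv1 := (unitOrd_eq_zero_iff hc).1 hv
      rw [← integral_comp_unit_mul (μ := μ) g hv1, ← integral_const_mul]
      congr 1
      ext w
      simp only [F]
      by_cases hw : w ∈ Metric.sphere (0 : L) 1
      · simp only [I]
        rw [Set.indicator_of_mem hw, one_mul]
      · simp only [I]
        rw [Set.indicator_of_notMem hw, hsupp]
        · simp
        · rw [norm_mul, hv1, one_mul]
          simpa using hw
    · simp only [F, J]
      rw [Set.indicator_of_notMem (mt mem_unitShell.1 hv)]
      simp
  simp only [hl, hr] at hswap
  rw [integral_mul_const, integral_mul_const, integral_indicator_const _ hsph.isOpen.measurableSet,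
    integral_indicator_const _ (isClopen_unitShell hc 0).isOpen.measurableSet] at hswap
  simpa using hswap

end Convolution

/-! ### The weak Mellin transform of a second degree character -/

section SecondDegree

variable {L : Type*} [NormedField L] [IsUltrametricDist L] {c : Lˣ} (hc : IsUniformizer (c : L))
  {ψ : AddChar L ℂ} (hψ : IsNormalized (c : L) ψ) {χ : Lˣ →ₜ* Circle} {a b : L} {m α : ℤ}

include hc hψ in
theorem exists_quadChar_eq_one (a b : L) :
    ∃ T : ℤ, ∀ x ∈ fracIdeal (c : L) T, quadChar ψ a b x = 1 := by
  have hopen : (fun x : L => a / 2 * x ^ 2 + b * x) ⁻¹' (fracIdeal (c : L) 0 : Set L) ∈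
      nhds (0 : L) :=
    ((isClopen_fracIdeal hc 0).isOpen.preimage (by fun_prop)).mem_nhds (by simp)
  obtain ⟨T, hT⟩ := exists_fracIdeal_subset hc hopen
  exact ⟨T, fun x hx => hψ.eq_one _ (hT hx)⟩

variable [ProperSpace L] [MeasurableSpace L] [BorelSpace L] [CharZero L]

include hψ in
/-- Far from the origin, a second degree character averages to zero over the cosets of a higher
unit group. -/
theorem exists_integral_quadChar_eq_zero (μ : Measure L) [μ.IsAddHaarMeasure] (ha : a ≠ 0)
    {N : ℤ} (hN : 1 ≤ N) : ∃ T : ℤ, ∀ y : Lˣ, unitOrd hc y ≤ T →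
      ∫ t, (fracIdeal (c : L) N : Set L).indicator (fun t => quadChar ψ a b ((1 + t) * y)) t ∂μ
        = 0 := by
  obtain ⟨α, hα⟩ := hc.exists_zpow a ha
  obtain ⟨α', hα'⟩ := exists_mem_fracIdeal hc (a / 2)
  obtain ⟨β, hβ⟩ := exists_mem_fracIdeal hc b
  set C := max 0 (-α') with hC
  refine ⟨min (C - N) (min (-α - 1 - C) (β - α - 1)), fun y hy => ?_⟩
  set v := unitOrd hc y with hv
  -- on `c ^ (C - v) 𝒪` the quadratic term is trivial but the linear term is not
  have hyv : (y : L) ∈ fracIdeal (c : L) v := (coe_mem_fracIdeal_iff hc).2 le_rfl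
  have hcont : Continuous fun t : L => quadChar ψ a b ((1 + t) * y) :=
    (hψ.continuous_quadChar hc a b).comp (by fun_prop)
  refine integral_eq_zero_of_coset_integrals μ (isClopen_fracIdeal hc (C - v))
    (isCompact_fracIdeal _) (continuous_indicator_fracIdeal hc N hcont)
    (HasCompactSupport.intro (isCompact_fracIdeal N)
      fun t ht => Set.indicator_of_notMem ht _) fun t => ?_
  by_cases ht : t ∈ fracIdeal (c : L) N
  · have ht1 : ‖1 + t‖ = 1 :=
      (norm_add_eq_one_iff hc (fracIdeal_anti hc hN ht)).2 norm_one
    set x := a * ((1 + t) * y) * y + b * y with hx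
    have hxv : x ∉ fracIdeal (c : L) (-(C - v)) := by
      intro hmem
      have h1 : b * (y : L) ∈ fracIdeal (c : L) (α + 2 * v + 1) :=
        fracIdeal_anti hc (by omega) (mul_mem_fracIdeal hc hβ hyv)
      have h2 : a * ((1 + t) * y) * y ∈ fracIdeal (c : L) (α + 2 * v + 1) := by
        have h3 := sub_mem (fracIdeal_anti hc (by omega) hmem) h1
        rwa [hx, add_sub_cancel_right] at h3
      rw [mem_fracIdeal, norm_mul, norm_mul, norm_mul, ht1, hα, norm_eq_zpow_unitOrd hc y, one_mul,
        ← zpow_add₀ hc.norm_pos.ne', ← zpow_add₀ hc.norm_pos.ne', hc.zpow_norm_le_iff] at h2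
      omega
    obtain ⟨w, hw, hne⟩ := hψ.exists_mul_ne_one hc hxv
    have hshift : Set.EqOn
        (fun s => (fracIdeal (c : L) N : Set L).indicator
          (fun t => quadChar ψ a b ((1 + t) * y)) (t + s))
        (fun s => quadChar ψ a b ((1 + t) * y) * ψ (x * s)) (fracIdeal (c : L) (C - v)) := by
      intro s hs
      have hs' : s ∈ fracIdeal (c : L) N := fracIdeal_anti hc (by omega) hs
      have hts : t + s ∈ (fracIdeal (c : L) N : Set L) := add_mem ht hs'
      have hquad : ψ (a / 2 * (y * s) * (y * s)) = 1 := by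
        apply hψ.eq_one
        have h3 := mul_mem_fracIdeal hc (mul_mem_fracIdeal hc hα'
          (mul_mem_fracIdeal hc hyv hs)) (mul_mem_fracIdeal hc hyv hs)
        exact fracIdeal_anti hc (by omega) h3
      simp only
      rw [Set.indicator_of_mem hts]
      have h4 : (1 + (t + s)) * (y : L) = (1 + t) * y + y * s := by ring
      rw [h4, quadChar_add, mul_assoc]
      congr 1
      rw [quadChar, ← AddChar.map_add_eq_mul]
      have h5 : a / 2 * (y * s) ^ 2 + b * (y * s) + a * ((1 + t) * y) * (y * s) =
          a / 2 * (y * s) * (y * s) + x * s := by rw [hx]; ring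
      rw [h5, AddChar.map_add_eq_mul, hquad, one_mul]
    rw [setIntegral_congr_fun (isClopen_fracIdeal hc _).isOpen.measurableSet hshift,
      integral_const_mul, setIntegral_eq_zero_of_nontrivial μ
        (isClopen_fracIdeal hc _).isOpen.measurableSet ?_ hw hne, mul_zero]
    intro x₁ _ x₂ _
    rw [mul_add, AddChar.map_add_eq_mul]
  · rw [setIntegral_congr_fun (g := fun _ => (0 : ℂ))
      (isClopen_fracIdeal hc _).isOpen.measurableSet]
    · simp
    · intro s hs
      have hs' : s ∈ fracIdeal (c : L) N := fracIdeal_anti hc (by omega) hs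
      exact Set.indicator_of_notMem (fun h => ht ((AddSubgroup.add_mem_cancel_right _ hs').1 h)) _

variable {ν : Measure Lˣ} [ν.IsHaarMeasure] {φ : Lˣ → ℂ}

omit [ProperSpace L] [MeasurableSpace L] [BorelSpace L] [CharZero L] in
include hc hψ in
theorem continuous_quadChar_units : Continuous fun x : Lˣ => quadChar ψ a b x :=
  (hψ.continuous_quadChar hc a b).comp Units.continuous_val

omit [ProperSpace L] [BorelSpace L] [CharZero L] [ν.IsHaarMeasure] in
include hψ in
theorem exists_mulConv_eq_const (hφc : HasCompactSupport φ) :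
    ∃ T : ℤ, ∀ y : Lˣ, T ≤ unitOrd hc y →
      mulConv ν φ (fun x : Lˣ => quadChar ψ a b x) y = ∫ x, φ x ∂ν := by
  obtain ⟨R, hR⟩ := exists_abs_unitOrd_le hc hφc
  obtain ⟨T, hT⟩ := exists_quadChar_eq_one hc hψ a b
  refine ⟨T + R, fun y hy => ?_⟩
  unfold mulConv
  congr 1
  ext x
  by_cases hx : φ x = 0
  · rw [hx, zero_mul]
  · beta_reduce
    rw [hT, mul_one]
    rw [coe_mem_fracIdeal_iff hc, unitOrd_mul, unitOrd_inv]
    have := abs_le.1 (hR x hx)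
    omega

include hψ in
theorem exists_mulConv_eq_zero (ha : a ≠ 0) (hφ : Continuous φ) (hφc : HasCompactSupport φ)
    {N : ℤ} (hN : 1 ≤ N)
    (hinv : ∀ x k : Lˣ, (k : L) - 1 ∈ fracIdeal (c : L) N → φ (x * k) = φ x) :
    ∃ T : ℤ, ∀ y : Lˣ, unitOrd hc y ≤ T →
      mulConv ν φ (fun x : Lˣ => quadChar ψ a b x) y = 0 := by
  set μ := Measure.addHaar (G := L)
  obtain ⟨R, hR⟩ := exists_abs_unitOrd_le hc hφc
  obtain ⟨T, hT⟩ := exists_integral_quadChar_eq_zero hc hψ (b := b) μ ha hN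
  refine ⟨T - R, fun y hy => ?_⟩
  set A := mulConv ν φ (fun x : Lˣ => quadChar ψ a b x) y with hA
  let I : L → ℂ := (fracIdeal (c : L) N : Set L).indicator fun _ => 1
  let F : L → Lˣ → ℂ := fun t x => I t * (φ x * quadChar ψ a b ((1 + t) * (x⁻¹ * y : Lˣ)))
  have hF : Continuous F.uncurry := by
    have h1 : Continuous I := continuous_indicator_fracIdeal hc N continuous_const
    have h2 : Continuous fun z : L × Lˣ => (1 + z.1) * ((z.2⁻¹ * y : Lˣ) : L) :=
      (continuous_const.add continuous_fst).mul (Units.continuous_val.comp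
        ((continuous_inv.comp continuous_snd).mul continuous_const))
    exact (h1.comp continuous_fst).mul ((hφ.comp continuous_snd).mul
      ((hψ.continuous_quadChar hc a b).comp h2))
  have hFc : HasCompactSupport F.uncurry := by
    refine HasCompactSupport.intro ((isCompact_fracIdeal (ϖ := (c : L)) N).prod hφc.isCompact) ?_
    rintro ⟨t, x⟩ htx
    by_contra hne
    refine htx ⟨?_, ?_⟩
    · by_contra ht
      exact left_ne_zero_of_mul hne (Set.indicator_of_notMem ht _)
    · exact subset_tsupport _ (left_ne_zero_of_mul (right_ne_zero_of_mul hne))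
  have hswap := integral_integral_swap_of_hasCompactSupport hF hFc (μ := μ) (ν := ν)
  have hl : ∀ t, ∫ x, F t x ∂ν = I t * A := by
    intro t
    simp only [F]
    rw [integral_const_mul]
    by_cases ht : t ∈ fracIdeal (c : L) N
    · congr 1
      have ht1 : ‖1 + t‖ = 1 :=
        (norm_add_eq_one_iff hc (fracIdeal_anti hc hN ht)).2 norm_one
      set k : Lˣ := Units.mk0 (1 + t) (norm_ne_zero_iff.1 (ht1 ▸ one_ne_zero)) with hk
      have hk1 : (k : L) - 1 ∈ fracIdeal (c : L) N := by simpa [hk] using ht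
      rw [hA, mulConv, ← integral_mul_right_eq_self _ k]
      congr 1
      ext x
      rw [hinv x k hk1]
      congr 2
      rw [mul_inv]
      push_cast
      simp only [hk, Units.val_mk0]
      have h0 : (1 + t) ≠ 0 := norm_ne_zero_iff.1 (ht1 ▸ one_ne_zero)
      field_simp
    · simp only [I]
      rw [Set.indicator_of_notMem ht, zero_mul, zero_mul]
  have hr : ∀ x, ∫ t, F t x ∂μ = 0 := by
    intro x
    by_cases hx : φ x = 0
    · simp [F, hx]
    · have h1 : ∀ t, F t x = φ x * (fracIdeal (c : L) N : Set L).indicator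
          (fun t => quadChar ψ a b ((1 + t) * (x⁻¹ * y : Lˣ))) t := by
        intro t
        by_cases ht : t ∈ (fracIdeal (c : L) N : Set L)
        · simp only [F, I, Set.indicator_of_mem ht, one_mul]
        · simp only [F, I, Set.indicator_of_notMem ht, zero_mul, mul_zero]
      simp only [h1]
      rw [integral_const_mul, hT, mul_zero]
      rw [unitOrd_mul, unitOrd_inv]
      have := abs_le.1 (hR x hx)
      omega
  simp only [hl, hr, integral_zero] at hswap
  rw [integral_mul_const, integral_indicator_const _
    (isClopen_fracIdeal hc N).isOpen.measurableSet] at hswap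
  have hpos : μ.real (fracIdeal (c : L) N : Set L) ≠ 0 :=
    (ENNReal.toReal_pos ((isClopen_fracIdeal hc N).isOpen.measure_pos μ ⟨0, zero_mem _⟩).ne'
      (isCompact_fracIdeal N).measure_lt_top.ne).ne'
  simpa [hpos] using hswap

include hψ in
/-- The weak Mellin transform of a second degree character is the sum of its integrals over the
shells, provided that only finitely many of these are nonzero. -/
theorem isWeakMellinAt_sum (ha : a ≠ 0) {s : ℂ} (hs : 0 < s.re) (S : Finset ℤ)
    (hS : ∀ n ∉ S, ∫ x in unitShell hc n, quadChar ψ a b x * quasiChar s χ x ∂ν = 0) :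
    IsWeakMellinAt ν (fun x : Lˣ => quadChar ψ a b x) s χ
      (∑ k ∈ S, ∫ x in unitShell hc k, quadChar ψ a b x * quasiChar s χ x ∂ν) := by
  intro φ hφ hφc
  have hf := continuous_quadChar_units hc hψ (a := a) (b := b)
  obtain ⟨N, hN, hinv⟩ := exists_higherUnits_invariant hc hφ hφc
  obtain ⟨T₁, hT₁⟩ := exists_mulConv_eq_const hc hψ (a := a) (b := b) (ν := ν) hφc
  obtain ⟨T₀, hT₀⟩ := exists_mulConv_eq_zero hc hψ (b := b) (ν := ν) ha hφ.continuous hφc hN hinv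
  have hconv : Continuous (mulConv ν φ fun x : Lˣ => quadChar ψ a b x) :=
    continuous_of_mul_higherUnits hc N fun y k hk =>
      mulConv_mul_of_invariant (fun x => hinv x k hk) y
  have hint : MellinWellDefined ν (mulConv ν φ fun x : Lˣ => quadChar ψ a b x) s χ :=
    mellinWellDefined_of_const_of_zero hc hconv hT₁ hT₀ hs
  exact ⟨fun y => integrable_mulConv hφ.continuous hφc hf y, hint,
    mellinTransform_mulConv hc hφ.continuous hφc hf s S hS hint⟩

omit [CharZero L] in
include hψ in
/-- The integral over a shell of `Lˣ` in terms of the shell coefficient. -/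
theorem setIntegral_unitShell_eq (μ : Measure L) [μ.IsAddHaarMeasure]
    (hm : IsConductor (c : L) χ m) (s : ℂ) (n : ℤ) :
    ∫ x in unitShell hc n, quadChar ψ a b x * quasiChar s χ x ∂ν =
      ((ν.real (unitShell hc 0) / μ.real (Metric.sphere (0 : L) 1) : ℝ) : ℂ) *
        (quasiChar s χ (c ^ n) * shellCoeff μ ψ χ c a b n) := by
  have hcoef := integral_units_eq hc (ν := ν) μ (continuous_shellFun hc hψ hm (a := a) (b := b) n)
    (fun x hx => by rw [shellFun, unitChar_of_norm_ne hx, mul_zero])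
  have hpos : (μ.real (Metric.sphere (0 : L) 1) : ℂ) ≠ 0 := by
    have hopen : IsOpen (Metric.sphere (0 : L) 1) := IsUltrametricDist.isOpen_sphere _ one_ne_zero
    exact_mod_cast (ENNReal.toReal_pos (hopen.measure_pos μ ⟨1, by simp⟩).ne'
      (isCompact_sphere _ _).measure_lt_top.ne).ne'
  have hshell : ∫ x in unitShell hc n, quadChar ψ a b x * quasiChar s χ x ∂ν =
      quasiChar s χ (c ^ n) * ∫ u : Lˣ, shellFun ψ χ (c : L) a b n u ∂ν := by
    rw [← integral_indicator (isClopen_unitShell hc n).isOpen.measurableSet,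
      ← integral_mul_left_eq_self _ (c ^ n), ← integral_const_mul]
    congr 1
    ext u
    by_cases hu : unitOrd hc u = 0
    · have hcu : c ^ n * u ∈ unitShell hc n := by
        rw [mem_unitShell, unitOrd_mul, unitOrd_zpow, hu, add_zero]
      rw [Set.indicator_of_mem hcu, quasiChar_mul, quasiChar_eq hc s χ u, hu, zpow_zero, one_mul,
        shellFun, unitChar_coe ((unitOrd_eq_zero_iff hc).1 hu), Units.val_mul,
        Units.val_zpow_eq_zpow_val]
      ring
    · have hcu : c ^ n * u ∉ unitShell hc n := by
        rw [mem_unitShell, unitOrd_mul, unitOrd_zpow]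
        omega
      rw [Set.indicator_of_notMem hcu, shellFun, unitChar_of_norm_ne, mul_zero, mul_zero]
      rwa [Ne, ← unitOrd_eq_zero_iff hc]
  rw [hshell, shellCoeff]
  push_cast
  field_simp
  linear_combination quasiChar s χ (c ^ n) * hcoef

/-! ### Uniqueness, and the zeros -/

omit [CharZero L] in
include hc in
/-- A weak Mellin transform is determined by testing it on the indicator function of a higher unit
group on which the character is trivial. -/
theorem IsWeakMellinAt.unique (hm : IsConductor (c : L) χ m) {f : Lˣ → ℂ} {s M M' : ℂ}
    (h : IsWeakMellinAt ν f s χ M) (h' : IsWeakMellinAt ν f s χ M') : M = M' := by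
  set K : Set Lˣ := (fun k : Lˣ => (k : L) - 1) ⁻¹' (fracIdeal (c : L) m) with hK
  have hKc : IsClopen K :=
    (isClopen_fracIdeal hc m).preimage (Units.continuous_val.sub continuous_const)
  have hnorm : ∀ k ∈ K, ‖(k : L)‖ = 1 := by
    intro k hk
    have := (norm_add_eq_one_iff hc (x := 1) (fracIdeal_anti hc hm.one_le hk)).2 norm_one
    simpa using this
  have hKcomp : IsCompact K := (isCompact_unitShell hc 0).of_isClosed_subset hKc.1
    fun k hk => (unitOrd_eq_zero_iff hc).2 (hnorm k hk)
  have hφ : IsLocallyConstant (K.indicator fun _ => (1 : ℂ)) :=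
    (LocallyConstant.charFn ℂ hKc).isLocallyConstant
  have hφc : HasCompactSupport (K.indicator fun _ => (1 : ℂ)) :=
    HasCompactSupport.intro hKcomp fun x hx => Set.indicator_of_notMem hx _
  have hmel : mellinTransform ν (K.indicator fun _ => (1 : ℂ)) s χ = ν.real K := by
    have h1 : ∀ x, K.indicator (fun _ => (1 : ℂ)) x * quasiChar s χ x =
        K.indicator (fun _ => (1 : ℂ)) x := by
      intro x
      by_cases hx : x ∈ K
      · have h2 := hm.eq_one _ hx
        rw [add_sub_cancel, unitChar_coe (hnorm x hx)] at h2
        rw [quasiChar_eq hc, (unitOrd_eq_zero_iff hc).2 (hnorm x hx), h2]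
        simp
      · rw [Set.indicator_of_notMem hx, zero_mul]
    rw [mellinTransform]
    simp only [h1]
    rw [integral_indicator_const _ hKc.isOpen.measurableSet]
    simp
  have hpos : (ν.real K : ℂ) ≠ 0 := by
    exact_mod_cast (ENNReal.toReal_pos (hKc.isOpen.measure_pos ν ⟨1, by simp [hK]⟩).ne'
      hKcomp.measure_lt_top.ne).ne'
  have e := (h _ hφ hφc).2.2.symm.trans (h' _ hφ hφc).2.2
  rw [hmel] at e
  exact mul_right_cancel₀ hpos e

omit [CharZero L] in
include hc in
theorem IsEntireZeta.unique (hm : IsConductor (c : L) χ m) {f : L → ℂ} {Z Z' : ℂ → ℂ}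
    (h : IsEntireZeta ν f χ Z) (h' : IsEntireZeta ν f χ Z') : Z = Z' := by
  refine AnalyticOnNhd.eq_of_eventuallyEq (𝕜 := ℂ) (z₀ := 1) (fun z _ => h.1.analyticAt z)
    (fun z _ => h'.1.analyticAt z) ?_
  have hopen : IsOpen {s : ℂ | 0 < s.re} := isOpen_lt continuous_const Complex.continuous_re
  filter_upwards [hopen.mem_nhds (by simp)] with s hs
  exact (h.2 s hs).unique hc hm (h'.2 s hs)

include hc hψ in
/-- At most two shell coefficients are nonzero, and they are exchanged by the reflection about the
centre `-(α + m) / 2`. -/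
theorem eq_or_eq_reflection (μ : Measure L) [μ.IsAddHaarMeasure] (hm : IsConductor (c : L) χ m)
    (ha : a ≠ 0) (hα : ‖a‖ = ‖(c : L)‖ ^ α) {n k : ℤ} (hn : shellCoeff μ ψ χ c a b n ≠ 0)
    (hk : shellCoeff μ ψ χ c a b k ≠ 0) : k = n ∨ k = -m - n - α := by
  have hrefl : ∀ l, shellCoeff μ ψ χ c a b l ≠ 0 → shellCoeff μ ψ χ c a b (-m - l - α) ≠ 0 := by
    intro l hl hzero
    have h1 := norm_sq_shellCoeff (μ := μ) (b := b) hc hψ hm ha hα l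
    rw [hzero, norm_zero, zero_pow two_ne_zero, zero_mul] at h1
    have h2 := zpow_pos (normAbs_pos c) l
    have h3 := norm_pos_iff.2 hl
    have : 0 < ‖shellCoeff μ ψ χ c a b l‖ ^ 2 * normAbs c ^ l := by positivity
    exact this.ne' h1
  have ha' : a ∈ fracIdeal (c : L) α := hα.le
  have hinner : ∀ i j, 0 ≤ 2 * i + α + m → 0 ≤ 2 * j + α + m → shellCoeff μ ψ χ c a b i ≠ 0 →
      shellCoeff μ ψ χ c a b j ≠ 0 → i = j := by
    intro i j hi hj hci hcj
    rcases lt_trichotomy i j with h | h | h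
    · exact absurd (shellCoeff_eq_zero_of_lt hc hψ hm ha' hi hci h) hcj
    · exact h
    · exact absurd (shellCoeff_eq_zero_of_lt hc hψ hm ha' hj hcj h) hci
  rcases le_total 0 (2 * n + α + m) with h1 | h1 <;> rcases le_total 0 (2 * k + α + m) with h2 | h2
  · exact Or.inl (hinner _ _ h2 h1 hk hn)
  · have := hinner _ _ (by omega) h1 (hrefl k hk) hn
    omega
  · have := hinner _ _ h2 (by omega) hk (hrefl n hn)
    omega
  · have := hinner _ _ (by omega) (by omega) (hrefl k hk) (hrefl n hn)
    omega

omit [IsUltrametricDist L] [MeasurableSpace L] [BorelSpace L] [CharZero L] in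
theorem norm_quasiChar_zpow (hc : IsUniformizer (c : L)) (s : ℂ) (n : ℤ) :
    ‖quasiChar s χ (c ^ n)‖ = (normAbs c ^ s.re) ^ n := by
  borelize L
  rw [quasiChar_eq hc, unitOrd_zpow, norm_mul, norm_zpow, Circle.norm_coe, mul_one,
    Complex.norm_cpow_eq_rpow_re_of_pos (normAbs_pos c)]

omit [IsUltrametricDist L] [CharZero L] in
include hc in
theorem differentiable_quasiChar_zpow (n : ℤ) :
    Differentiable ℂ fun s => quasiChar s χ (c ^ n) := by
  have h0 : (normAbs c : ℂ) ≠ 0 := by exact_mod_cast (normAbs_pos c).ne'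
  simp only [quasiChar_eq hc]
  refine Differentiable.mul_const ?_ _
  intro s
  refine (DifferentiableAt.const_cpow differentiableAt_id (Or.inl h0)).zpow (Or.inl ?_)
  rw [Complex.cpow_def_of_ne_zero h0]
  exact Complex.exp_ne_zero _

include hc hψ in
/-- The zeta function of a second degree character exists, and is a sum of at most two exponentials
whose coefficients are balanced on the critical line. -/
theorem exists_isEntireZeta (hm : IsConductor (c : L) χ m) (ha : a ≠ 0) :
    ∃ Z : ℂ → ℂ, IsEntireZeta ν (quadChar ψ a b) χ Z ∧
      ((∃ s, Z s ≠ 0) → ∀ s, Z s = 0 → s.re = 1 / 2) := by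
  classical
  set μ := Measure.addHaar (G := L)
  obtain ⟨α, hα⟩ := hc.exists_zpow a ha
  set κ : ℂ := ((ν.real (unitShell hc 0) / μ.real (Metric.sphere (0 : L) 1) : ℝ) : ℂ) with hκ
  have hzeta : ∀ S : Finset ℤ, (∀ n ∉ S, shellCoeff μ ψ χ c a b n = 0) →
      IsEntireZeta ν (quadChar ψ a b) χ
        (fun s => ∑ k ∈ S, κ * (quasiChar s χ (c ^ k) * shellCoeff μ ψ χ c a b k)) := by
    intro S hS
    refine ⟨?_, fun s hs => ?_⟩
    · exact Differentiable.fun_sum fun k _ =>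
        ((differentiable_quasiChar_zpow hc k).mul_const _).const_mul _
    · simp only [hκ, ← setIntegral_unitShell_eq hc hψ (ν := ν) μ hm s]
      refine isWeakMellinAt_sum hc hψ ha hs S fun n hn => ?_
      rw [setIntegral_unitShell_eq hc hψ μ hm, hS n hn, mul_zero, mul_zero]
  by_cases hex : ∃ n, shellCoeff μ ψ χ c a b n ≠ 0
  · obtain ⟨n, hn⟩ := hex
    set n' := -m - n - α with hn'
    refine ⟨_, hzeta {n, n'} fun k hk => ?_, fun hne s hZ => ?_⟩
    · by_contra hk0
      rcases eq_or_eq_reflection hc hψ μ hm ha hα hn hk0 with rfl | rfl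
      · exact hk (by simp)
      · exact hk (by simp [hn'])
    · have hκ0 : κ ≠ 0 := by
        rintro h0
        obtain ⟨t, ht⟩ := hne
        simp [h0] at ht
      rw [← Finset.mul_sum, mul_eq_zero, or_iff_right hκ0] at hZ
      have hr := normAbs_pos c
      have hr1 := normAbs_uniformizer_lt_one hc
      have hρ : 0 < normAbs c ^ s.re := Real.rpow_pos_of_pos hr _
      have hcn := norm_pos_iff.2 hn
      by_cases hnn : n = n'
      · rw [← hnn] at hZ
        have h1 := congrArg norm hZ
        rw [Finset.pair_eq_singleton, Finset.sum_singleton, norm_mul, norm_quasiChar_zpow hc,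
          norm_zero] at h1
        exact absurd h1 (mul_pos (zpow_pos hρ _) hcn).ne'
      · rw [Finset.sum_pair hnn] at hZ
        have hsym := norm_sq_shellCoeff (μ := μ) (b := b) hc hψ hm ha hα n
        rw [← hn'] at hsym
        have h1 := congrArg norm (eq_neg_of_add_eq_zero_left hZ)
        rw [norm_neg, norm_mul, norm_mul, norm_quasiChar_zpow hc, norm_quasiChar_zpow hc] at h1
        have hcn' : 0 < ‖shellCoeff μ ψ χ c a b n'‖ := by
          refine lt_of_le_of_ne (norm_nonneg _) fun h0 => ?_
          rw [← h0, mul_zero] at h1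
          exact (mul_pos (zpow_pos hρ _) hcn).ne' h1
        -- comparing logarithms of the two relations between the coefficients
        have l1 := congrArg Real.log hsym
        have l2 := congrArg Real.log h1
        rw [Real.log_mul (by positivity) (zpow_pos hr _).ne',
          Real.log_mul (by positivity) (zpow_pos hr _).ne', Real.log_pow, Real.log_pow,
          Real.log_zpow, Real.log_zpow] at l1
        rw [Real.log_mul (zpow_pos hρ _).ne' hcn.ne', Real.log_mul (zpow_pos hρ _).ne' hcn'.ne',
          Real.log_zpow, Real.log_zpow, Real.log_rpow hr] at l2
        have hlog : Real.log (normAbs c) ≠ 0 := (Real.log_neg hr hr1).ne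
        have hdiff : ((n : ℝ) - n') ≠ 0 := sub_ne_zero.2 (by exact_mod_cast hnn)
        have h2 : ((n : ℝ) - n') * Real.log (normAbs c) * (2 * s.re - 1) = 0 := by
          push_cast at l1
          linear_combination 2 * l2 - l1
        have h3 := (mul_eq_zero.1 h2).resolve_left (mul_ne_zero hdiff hlog)
        linarith
  · push Not at hex
    refine ⟨_, hzeta ∅ fun n _ => hex n, fun ⟨s, hs⟩ => ?_⟩
    simp at hs

end SecondDegree

/-! ### The standard additive character -/

section Padic

variable (p : ℕ) [Fact p.Prime]

theorem padicChar_add (x y : ℚ_[p]) : padicChar p (x + y) = padicChar p x * padicChar p y := by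
  have hp0 : (p : ℚ) ≠ 0 := by exact_mod_cast (Fact.out : p.Prime).ne_zero
  obtain ⟨r, hr⟩ := exists_isPrincipalPart p x
  obtain ⟨t, ht⟩ := exists_isPrincipalPart p y
  have hrt : IsPrincipalPart p (x + y) (r + t) := by
    obtain ⟨⟨n, k, hn⟩, h1⟩ := hr
    obtain ⟨⟨l, j, hl⟩, h2⟩ := ht
    refine ⟨⟨n * p ^ j + l * p ^ k, k + j, ?_⟩, ?_⟩
    · rw [hn, hl]
      push_cast
      rw [pow_add]
      field_simp
    · push_cast
      rw [add_sub_add_comm]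
      exact (Padic.nonarchimedean _ _).trans (max_le h1 h2)
  rw [padicChar_eq p _ _ hr, padicChar_eq p _ _ ht, padicChar_eq p _ _ hrt, ← Complex.exp_add]
  push_cast
  ring_nf

theorem norm_padicChar (x : ℚ_[p]) : ‖padicChar p x‖ = 1 := by
  obtain ⟨r, hr⟩ := exists_isPrincipalPart p x
  have h1 : (2 * Real.pi * Complex.I * (r : ℂ)) = ((2 * Real.pi * r : ℝ) : ℂ) * Complex.I := by
    push_cast
    ring
  rw [padicChar_eq p _ _ hr, h1, Complex.norm_exp_ofReal_mul_I]

theorem padicChar_eq_one {x : ℚ_[p]} (hx : ‖x‖ ≤ 1) : padicChar p x = 1 := by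
  rw [padicChar_eq p x 0 ⟨⟨0, 0, by simp⟩, by simpa using hx⟩]
  simp

theorem padicChar_inv_ne_one : padicChar p (p : ℚ_[p])⁻¹ ≠ 1 := by
  have hp := (Fact.out : p.Prime).one_lt
  have hr : IsPrincipalPart p (p : ℚ_[p])⁻¹ (1 / (p : ℚ)) :=
    ⟨⟨1, 1, by simp⟩, by push_cast; simp⟩
  rw [padicChar_eq p _ _ hr, Ne, Complex.exp_eq_one_iff]
  rintro ⟨n, hn⟩
  have hpi : (2 * Real.pi * Complex.I : ℂ) ≠ 0 := Complex.two_pi_I_ne_zero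
  have h1 : ((1 / (p : ℚ) : ℚ) : ℂ) = n := by
    rw [mul_comm (n : ℂ)] at hn
    exact mul_left_cancel₀ hpi hn
  have h2 : (1 / (p : ℚ)) = n := by exact_mod_cast h1
  have hp0 : (p : ℚ) ≠ 0 := by positivity
  have h3 : (1 : ℚ) = n * p := by
    rw [← h2]
    field_simp
  have h4 : (1 : ℤ) = n * p := by exact_mod_cast h3
  have h5 : (p : ℤ) ∣ 1 := ⟨n, by rw [h4]; ring⟩
  have h6 : p ∣ 1 := by exact_mod_cast h5
  have := Nat.le_of_dvd one_pos h6
  omega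

variable {L : Type*} [NormedField L] [NormedAlgebra ℚ_[p] L]

/-- The standard character of `L`, as an additive character. -/
noncomputable def stdAddChar : AddChar L ℂ where
  toFun := stdChar p
  map_zero_eq_one' := by
    rw [stdChar, map_zero]
    exact padicChar_eq_one p (by simp)
  map_add_eq_mul' x y := by
    rw [stdChar, map_add, padicChar_add]
    rfl

theorem stdAddChar_apply (x : L) : stdAddChar p x = padicChar p (Algebra.trace ℚ_[p] L x) := rfl

/-- A nontrivial unitary character that is trivial near `0` becomes normalized after rescaling by
a power of the uniformizer. -/
theorem exists_isNormalized {L : Type*} [NormedField L] [IsUltrametricDist L] {ϖ : L}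
    (hϖ : IsUniformizer ϖ) {Ψ : AddChar L ℂ} (hnorm : ∀ x, ‖Ψ x‖ = 1)
    (htriv : {x | Ψ x = 1} ∈ nhds (0 : L)) (hne : ∃ x, Ψ x ≠ 1) :
    ∃ (δ : L) (ψ : AddChar L ℂ), δ ≠ 0 ∧ IsNormalized ϖ ψ ∧ ∀ x, Ψ x = ψ (δ * x) := by
  obtain ⟨k, hk⟩ := exists_fracIdeal_subset hϖ htriv
  obtain ⟨x₀, hx₀⟩ := hne
  obtain ⟨l, hl⟩ := exists_mem_fracIdeal hϖ x₀
  obtain ⟨d, hd, hmin⟩ := Int.exists_least_of_bdd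
    (P := fun d : ℤ => ∀ x ∈ fracIdeal ϖ d, Ψ x = 1)
    ⟨l, fun z hz => by
      by_contra h
      exact hx₀ (hz _ (fracIdeal_anti hϖ (by omega) hl))⟩ ⟨k, fun x hx => hk hx⟩
  refine ⟨ϖ ^ (-d), Ψ.compAddMonoidHom (AddMonoidHom.mulLeft (ϖ ^ d)),
    zpow_ne_zero _ hϖ.ne_zero, ⟨fun x => hnorm _, fun x hx => hd _ ?_, ?_⟩, fun x => ?_⟩
  · rw [AddMonoidHom.coe_mulLeft, zpow_mul_mem_fracIdeal_iff hϖ, sub_self]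
    exact hx
  · have h1 : ¬ ∀ x ∈ fracIdeal ϖ (d - 1), Ψ x = 1 := fun h => by
      have := hmin _ h
      omega
    push Not at h1
    obtain ⟨x, hx, hx1⟩ := h1
    refine ⟨ϖ ^ (-d) * x, ?_, ?_⟩
    · rw [zpow_mul_mem_fracIdeal_iff hϖ]
      exact fracIdeal_anti hϖ (by omega) hx
    · rw [AddChar.compAddMonoidHom_apply, AddMonoidHom.coe_mulLeft, ← mul_assoc,
        ← zpow_add₀ hϖ.ne_zero]
      simpa using hx1
  · rw [AddChar.compAddMonoidHom_apply, AddMonoidHom.coe_mulLeft, ← mul_assoc,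
        ← zpow_add₀ hϖ.ne_zero]
    simp

theorem stdAddChar_trivial_near_zero [FiniteDimensional ℚ_[p] L] :
    {x | stdAddChar p x = 1} ∈ nhds (0 : L) := by
  have hcont : Continuous (Algebra.trace ℚ_[p] L) := LinearMap.continuous_of_finiteDimensional _
  have hopen : IsOpen (Algebra.trace ℚ_[p] L ⁻¹' Metric.ball 0 1) :=
    Metric.isOpen_ball.preimage hcont
  refine Filter.mem_of_superset (hopen.mem_nhds (by simp)) fun x hx => ?_
  exact padicChar_eq_one p (by simpa using (le_of_lt (by simpa using hx : ‖_‖ < (1 : ℝ))))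

theorem exists_stdAddChar_ne_one [FiniteDimensional ℚ_[p] L] : ∃ x : L, stdAddChar p x ≠ 1 := by
  obtain ⟨x, hx⟩ := Algebra.trace_surjective ℚ_[p] L (p : ℚ_[p])⁻¹
  exact ⟨x, by rw [stdAddChar_apply, hx]; exact padicChar_inv_ne_one p⟩

end Padic

end WeakMellin

open WeakMellin

theorem mainTheorem3 (p : ℕ) [Fact p.Prime] (L : Type*) [NormedField L] [NormedAlgebra ℚ_[p] L]
    [FiniteDimensional ℚ_[p] L] [LocallyCompactSpace L] [MeasurableSpace L] [BorelSpace L]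
    (ν : MeasureTheory.Measure Lˣ) [ν.IsHaarMeasure] (a b : L) (ha : a ≠ 0)
    (χ : Lˣ →ₜ* Circle) (hχ : WeakMellin.IsRamified χ) :
    (∃! Z : ℂ → ℂ, WeakMellin.IsEntireZeta ν (WeakMellin.secondDegreeChar p a b) χ Z) ∧
    ∀ Z : ℂ → ℂ, WeakMellin.IsEntireZeta ν (WeakMellin.secondDegreeChar p a b) χ Z →
      (∃ s : ℂ, Z s ≠ 0) → ∀ s : ℂ, Z s = 0 → s.re = 1 / 2 := by
  have : CharZero L := charZero_of_injective_algebraMap (algebraMap ℚ_[p] L).injective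
  have : IsUltrametricDist L := IsUltrametricDist.of_normedAlgebra ℚ_[p]
  have : ProperSpace L := FiniteDimensional.proper ℚ_[p] L
  have hp0 : (p : L) ≠ 0 := by exact_mod_cast (Fact.out : p.Prime).ne_zero
  have hp1 : ‖(p : L)‖ < 1 := by
    rw [← map_natCast (algebraMap ℚ_[p] L), norm_algebraMap']
    exact Padic.norm_p_lt_one
  obtain ⟨ϖ, hϖ⟩ := exists_isUniformizer hp0 hp1
  set c : Lˣ := Units.mk0 ϖ hϖ.ne_zero
  have hc : IsUniformizer (c : L) := hϖ
  obtain ⟨m, hm⟩ := exists_isConductor hc hχ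
  obtain ⟨δ, ψ, hδ, hψ, hδψ⟩ := exists_isNormalized hc (Ψ := stdAddChar p)
    (fun x => norm_padicChar p _) (stdAddChar_trivial_near_zero p) (exists_stdAddChar_ne_one p)
  have hf : secondDegreeChar p a b = quadChar ψ (δ * a) (δ * b) := by
    ext x
    have h1 : δ * a / 2 * x ^ 2 + δ * b * x = δ * (a / 2 * x ^ 2 + b * x) := by ring
    rw [quadChar, h1, ← hδψ]
    rfl
  rw [hf]
  obtain ⟨Z, hZ, hzeros⟩ := exists_isEntireZeta (ν := ν) (b := δ * b) hc hψ hm (mul_ne_zero hδ ha)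
  refine ⟨⟨Z, hZ, fun Z' hZ' => hZ'.unique hc hm hZ⟩, fun Z' hZ' => ?_⟩
  rw [hZ'.unique hc hm hZ]
  exact hzeros
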